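/- Let $X$ be a locally compact metrizable space, $\phi:X\to X$ a homeomorphism, and $C_0(X)$ the algebra of continuous complex-valued functions on $X$ vanishing at infinity. Let $\rho$ be a faithful $*$-representation of $C_0(X)$ on a complex Hilbert space $\mathcal H_0$. For $n\in\mathbb Z_+=\{0,1,2,\dots\}$ and $f\in C_0(X)$ let $U^nf$ be the bounded operator on $\mathcal H_0\otimes\ell^2(\mathbb Z_+)$ determined by $$U^nf(\xi\otimes e_k)=\rho(f\circ\phi^k)\xi\otimes e_{k+n}\qquad(\xi\in\mathcal H_0,\ k\in\mathbb Z_+).$$ The semicrossed product $\mathcal A=C_0(X)\times_\phi\mathbb Z_+$ is the operator-norm closure of the set of all operators $\sum_{n}U^nf_n$ with $f_n\in C_0(X)$ and $\sum_n\|f_n\|<\infty$; it is an algebra of operators. The Fourier coefficient maps $E_m:\mathcal A\to C_0(X)$, $m\in\mathbb Z_+$, are the contractive linear extensions to $\mathcal A$ of $\sum_nU^nf_n\mapsto f_m$. For $A,B\in\mathcal A$ let $M_{A,B}:\mathcal A\to\mathcal A$, $M_{A,B}(T)=ATB$. **Theorem.** Let $A,B\in\mathcal A$ and put $f_m=E_m(A)$,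 $g_m=E_m(B)$ for $m\in\mathbb Z_+$. The following are equivalent. 1. The multiplication operator $M_{A,B}:\mathcal A\to\mathcal A$ is compact. 2. For all $m,n\in\mathbb Z_+$: (a) $f_m(\phi^{n+l}(x))\,g_n(x)=0$ for all $l\in\mathbb Z_+$ and every accumulation point $x$ of $X$; (b) $\lim_{l\to\infty}f_m(\phi^{n+l}(x))\,g_n(x)=0$ for every isolated point $x$ of $X$; (c) the sequence of functions $\{(f_m\circ\phi^{n+l})\,g_n\}_{l\in\mathbb Z_+}$ is equicontinuous at every point of $X$. -/

import Mathlib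

open scoped ZeroAtInfty ENNReal

noncomputable section

namespace Semicrossed

universe u v

section Action

variable {X : Type u} [TopologicalSpace X]

/-- The action of `n ∈ ℤ₊` on `C₀(X)`: the function `f ∘ φⁿ`, where `φⁿ` is the `n`-th iterate. -/
def act (φ : X ≃ₜ X) (n : ℕ) (f : C₀(X, ℂ)) : C₀(X, ℂ) where
  toFun x := f (φ^[n] x)
  continuous_toFun := f.continuous.comp (φ.continuous.iterate n)
  zero_at_infty' := by
    have h : Filter.Tendsto (φ^[n]) (Filter.cocompact X) (Filter.cocompact X) := by
      induction n with
      | zero => exact Filter.tendsto_id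
      | succ k ih =>
        rw [Function.iterate_succ]
        exact ih.comp φ.isClosedEmbedding.tendsto_cocompact
    exact (zero_at_infty f).comp h

@[simp] theorem act_apply (φ : X ≃ₜ X) (n : ℕ) (f : C₀(X, ℂ)) (x : X) :
    act φ n f x = f (φ^[n] x) := rfl

theorem act_zero (φ : X ≃ₜ X) (f : C₀(X, ℂ)) : act φ 0 f = f := rfl

theorem act_add (φ : X ≃ₜ X) (n : ℕ) (f g : C₀(X, ℂ)) :
    act φ n (f + g) = act φ n f + act φ n g := rfl

theorem act_smul (φ : X ≃ₜ X) (n : ℕ) (c : ℂ) (f : C₀(X, ℂ)) :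
    act φ n (c • f) = c • act φ n f := rfl

theorem act_mul (φ : X ≃ₜ X) (n : ℕ) (f g : C₀(X, ℂ)) :
    act φ n (f * g) = act φ n f * act φ n g := rfl

theorem act_act (φ : X ≃ₜ X) (m n : ℕ) (f : C₀(X, ℂ)) :
    act φ m (act φ n f) = act φ (m + n) f := by
  ext x
  simp [Nat.add_comm m n, Function.iterate_add_apply]

theorem norm_le_of_forall {f : C₀(X, ℂ)} {C : ℝ} (hC : 0 ≤ C) (h : ∀ x, ‖f x‖ ≤ C) : ‖f‖ ≤ C := by
  rw [← ZeroAtInftyContinuousMap.norm_toBCF_eq_norm]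
  exact (BoundedContinuousFunction.norm_le hC).2 h

theorem norm_apply_le (f : C₀(X, ℂ)) (x : X) : ‖f x‖ ≤ ‖f‖ := by
  rw [← ZeroAtInftyContinuousMap.norm_toBCF_eq_norm]
  exact f.toBCF.norm_coe_le_norm x

theorem norm_act_le (φ : X ≃ₜ X) (n : ℕ) (f : C₀(X, ℂ)) : ‖act φ n f‖ ≤ ‖f‖ :=
  norm_le_of_forall (norm_nonneg f) fun _ => norm_apply_le f _

end Action

section Hilbert

variable (H₀ : Type v) [NormedAddCommGroup H₀]

/-- The Hilbert space `H₀ ⊗ ℓ²(ℤ₊)`, realized as the Hilbert space of square summable sequences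
in `H₀`. -/
def HSpace : Type v := lp (fun _ : ℕ => H₀) 2

instance : NormedAddCommGroup (HSpace H₀) :=
  inferInstanceAs (NormedAddCommGroup (lp (fun _ : ℕ => H₀) 2))

variable {H₀}

/-- The elementary tensor `ξ ⊗ e_k`. -/
def tensor (k : ℕ) (ξ : H₀) : HSpace H₀ := lp.single (E := fun _ : ℕ => H₀) 2 k ξ

theorem norm_tensor (k : ℕ) (ξ : H₀) : ‖tensor k ξ‖ = ‖ξ‖ :=
  lp.norm_single (E := fun _ : ℕ => H₀) (p := 2) (by simp) k ξ

variable (H₀) [InnerProductSpace ℂ H₀]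

instance : InnerProductSpace ℂ (HSpace H₀) :=
  inferInstanceAs (InnerProductSpace ℂ (lp (fun _ : ℕ => H₀) 2))

instance [CompleteSpace H₀] : CompleteSpace (HSpace H₀) :=
  inferInstanceAs (CompleteSpace (lp (fun _ : ℕ => H₀) 2))

variable {H₀}

/-- The `k`-th coordinate of an element of `H₀ ⊗ ℓ²(ℤ₊)`. -/
def coord (k : ℕ) : HSpace H₀ →L[ℂ] H₀ :=
  LinearMap.mkContinuous
    { toFun := fun ξ => (show lp (fun _ : ℕ => H₀) 2 from ξ) k
      map_add' := fun _ _ => rfl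
      map_smul' := fun _ _ => rfl }
    1 (fun ξ => by
      rw [one_mul]
      exact lp.norm_apply_le_norm (E := fun _ : ℕ => H₀) (by simp) ξ k)

theorem hspace_ext {ξ η : HSpace H₀} (h : ∀ k, coord k ξ = coord k η) : ξ = η :=
  lp.ext (E := fun _ : ℕ => H₀) (p := 2) (funext h)

theorem coord_tensor_self (k : ℕ) (ξ : H₀) : coord k (tensor k ξ) = ξ :=
  lp.single_apply_self (E := fun _ : ℕ => H₀) 2 k ξ

theorem coord_tensor_ne {j k : ℕ} (h : j ≠ k) (ξ : H₀) : coord j (tensor k ξ) = 0 :=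
  lp.single_apply_ne (E := fun _ : ℕ => H₀) 2 k ξ h

theorem norm_coord_le (k : ℕ) (ξ : HSpace H₀) : ‖coord k ξ‖ ≤ ‖ξ‖ :=
  lp.norm_apply_le_norm (E := fun _ : ℕ => H₀) (p := 2) (by simp) ξ k

theorem summable_sq (ξ : HSpace H₀) : Summable fun k => ‖coord k ξ‖ ^ 2 := by
  have h := (lp.memℓp (E := fun _ : ℕ => H₀) (p := 2) ξ).summable (by simp)
  simp only [ENNReal.toReal_ofNat, Real.rpow_ofNat] at h
  exact h

theorem norm_sq_eq (ξ : HSpace H₀) : ‖ξ‖ ^ 2 = ∑' k, ‖coord k ξ‖ ^ 2 := by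
  have h := lp.norm_rpow_eq_tsum (E := fun _ : ℕ => H₀) (p := 2) (by simp) ξ
  simp only [ENNReal.toReal_ofNat, Real.rpow_ofNat] at h
  exact h

/-- The element of `H₀ ⊗ ℓ²(ℤ₊)` given by a square summable sequence. -/
def ofSeq (u : ℕ → H₀) (h : Summable fun k => ‖u k‖ ^ 2) : HSpace H₀ :=
  (⟨u, memℓp_gen (by simpa using h)⟩ : lp (fun _ : ℕ => H₀) 2)

@[simp] theorem coord_ofSeq (u : ℕ → H₀) (h : Summable fun k => ‖u k‖ ^ 2) (k : ℕ) :
    coord k (ofSeq u h) = u k := rfl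

theorem norm_ofSeq_le {u : ℕ → H₀} (h : Summable fun k => ‖u k‖ ^ 2) {ξ : HSpace H₀} {C : ℝ}
    (hC : 0 ≤ C) (hu : ∑' k, ‖u k‖ ^ 2 ≤ C ^ 2 * ∑' k, ‖coord k ξ‖ ^ 2) :
    ‖ofSeq u h‖ ≤ C * ‖ξ‖ := by
  refine le_of_sq_le_sq ?_ (by positivity)
  rw [mul_pow, norm_sq_eq, norm_sq_eq]
  exact hu

/-- The coordinates of the shifted sequence `(0, ξ₀, ξ₁, …)`. -/
def shiftSeq (ξ : HSpace H₀) : ℕ → H₀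
  | 0 => 0
  | k + 1 => coord k ξ

theorem summable_shiftSeq (ξ : HSpace H₀) : Summable fun k => ‖shiftSeq ξ k‖ ^ 2 :=
  (summable_nat_add_iff 1).1 (summable_sq ξ)

theorem tsum_shiftSeq (ξ : HSpace H₀) :
    ∑' k, ‖shiftSeq ξ k‖ ^ 2 = ∑' k, ‖coord k ξ‖ ^ 2 := by
  rw [(summable_shiftSeq ξ).tsum_eq_zero_add]
  simp [shiftSeq]

/-- The unilateral shift `ξ ⊗ e_k ↦ ξ ⊗ e_{k+1}`. -/
def shift : HSpace H₀ →L[ℂ] HSpace H₀ :=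
  LinearMap.mkContinuous
    { toFun := fun ξ => ofSeq (shiftSeq ξ) (summable_shiftSeq ξ)
      map_add' := fun ξ η => hspace_ext fun k => by
        cases k <;> simp [shiftSeq]
      map_smul' := fun c ξ => hspace_ext fun k => by
        cases k <;> simp [shiftSeq] }
    1 (fun ξ => norm_ofSeq_le (summable_shiftSeq ξ) zero_le_one (by rw [tsum_shiftSeq, one_pow, one_mul]))

@[simp] theorem coord_zero_shift (ξ : HSpace H₀) : coord 0 (shift ξ) = 0 := rfl

@[simp] theorem coord_succ_shift (ξ : HSpace H₀) (k : ℕ) :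
    coord (k + 1) (shift ξ) = coord k ξ := rfl

theorem coord_shift_pow_add (n : ℕ) (ξ : HSpace H₀) (k : ℕ) :
    coord (k + n) ((shift ^ n : HSpace H₀ →L[ℂ] HSpace H₀) ξ) = coord k ξ := by
  induction n generalizing k with
  | zero => simp
  | succ n ih =>
    rw [pow_succ', mul_apply_eq_comp, ← Nat.add_assoc, coord_succ_shift, ih]

theorem coord_shift_pow_lt (n : ℕ) (ξ : HSpace H₀) (k : ℕ) (hk : k < n) :
    coord k ((shift ^ n : HSpace H₀ →L[ℂ] HSpace H₀) ξ) = 0 := by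
  induction n generalizing k with
  | zero => omega
  | succ n ih =>
    rw [pow_succ', mul_apply_eq_comp]
    cases k with
    | zero => rfl
    | succ k => rw [coord_succ_shift, ih k (by omega)]

theorem norm_shift_apply_le (ξ : HSpace H₀) : ‖shift ξ‖ ≤ ‖ξ‖ :=
  ((shift : HSpace H₀ →L[ℂ] HSpace H₀).le_of_opNorm_le
    (LinearMap.mkContinuous_norm_le _ zero_le_one _) ξ).trans_eq (one_mul _)

end Hilbert

section Representation

variable {X : Type u} [TopologicalSpace X]
  {H₀ : Type v} [NormedAddCommGroup H₀] [InnerProductSpace ℂ H₀] [CompleteSpace H₀]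
  (φ : X ≃ₜ X) (ρ : C₀(X, ℂ) →⋆ₙₐ[ℂ] (H₀ →L[ℂ] H₀))

theorem norm_rho_act_le (k : ℕ) (f : C₀(X, ℂ)) (ξ : H₀) :
    ‖ρ (act φ k f) ξ‖ ≤ ‖f‖ * ‖ξ‖ :=
  ((ρ (act φ k f)).le_opNorm ξ).trans (mul_le_mul_of_nonneg_right
    ((NonUnitalStarAlgHom.norm_apply_le ρ _).trans (norm_act_le φ k f)) (norm_nonneg ξ))

theorem summable_diag (f : C₀(X, ℂ)) (ξ : HSpace H₀) :
    Summable fun k => ‖ρ (act φ k f) (coord k ξ)‖ ^ 2 := by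
  refine Summable.of_nonneg_of_le (fun _ => by positivity) (fun k => ?_)
    ((summable_sq ξ).mul_left (‖f‖ ^ 2))
  rw [← mul_pow]
  exact pow_le_pow_left₀ (norm_nonneg _) (norm_rho_act_le φ ρ k f _) 2

/-- The operator `ξ ⊗ e_k ↦ (f ∘ φᵏ) ξ ⊗ e_k`. -/
def diag (f : C₀(X, ℂ)) : HSpace H₀ →L[ℂ] HSpace H₀ :=
  LinearMap.mkContinuous
    { toFun := fun ξ => ofSeq (fun k => ρ (act φ k f) (coord k ξ)) (summable_diag φ ρ f ξ)
      map_add' := fun ξ η => hspace_ext fun k => by simp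
      map_smul' := fun c ξ => hspace_ext fun k => by simp }
    ‖f‖ (fun ξ => norm_ofSeq_le (summable_diag φ ρ f ξ) (norm_nonneg f) (by
      rw [← tsum_mul_left]
      refine (summable_diag φ ρ f ξ).tsum_le_tsum (fun k => ?_)
        ((summable_sq ξ).mul_left (‖f‖ ^ 2))
      rw [← mul_pow]
      exact pow_le_pow_left₀ (norm_nonneg _) (norm_rho_act_le φ ρ k f _) 2))

@[simp] theorem coord_diag (f : C₀(X, ℂ)) (ξ : HSpace H₀) (k : ℕ) :
    coord k (diag φ ρ f ξ) = ρ (act φ k f) (coord k ξ) := rfl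

/-- The operator `π(Uⁿ f)`, that is `ξ ⊗ e_k ↦ (f ∘ φᵏ) ξ ⊗ e_{k+n}`. -/
def monomial (n : ℕ) (f : C₀(X, ℂ)) : HSpace H₀ →L[ℂ] HSpace H₀ :=
  shift ^ n * diag φ ρ f

theorem coord_monomial_add (n : ℕ) (f : C₀(X, ℂ)) (ξ : HSpace H₀) (k : ℕ) :
    coord (k + n) (monomial φ ρ n f ξ) = ρ (act φ k f) (coord k ξ) := by
  rw [monomial, mul_apply_eq_comp, coord_shift_pow_add, coord_diag]

theorem coord_monomial_lt (n : ℕ) (f : C₀(X, ℂ)) (ξ : HSpace H₀) (k : ℕ) (hk : k < n) :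
    coord k (monomial φ ρ n f ξ) = 0 := by
  rw [monomial, mul_apply_eq_comp, coord_shift_pow_lt _ _ _ hk]

theorem monomial_ext {n : ℕ} {f : C₀(X, ℂ)} {T : HSpace H₀ →L[ℂ] HSpace H₀}
    (h₁ : ∀ ξ k, coord (k + n) (T ξ) = ρ (act φ k f) (coord k ξ))
    (h₂ : ∀ ξ k, k < n → coord k (T ξ) = 0) : T = monomial φ ρ n f := by
  refine ContinuousLinearMap.ext fun ξ => hspace_ext fun k => ?_
  rcases lt_or_ge k n with hk | hk
  · rw [h₂ ξ k hk, coord_monomial_lt φ ρ n f ξ k hk]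
  · obtain ⟨j, rfl⟩ := Nat.exists_eq_add_of_le' hk
    rw [h₁, coord_monomial_add]

theorem monomial_tensor (n : ℕ) (f : C₀(X, ℂ)) (k : ℕ) (ξ : H₀) :
    monomial φ ρ n f (tensor k ξ) = tensor (k + n) (ρ (act φ k f) ξ) := by
  refine hspace_ext fun j => ?_
  rcases lt_or_ge j n with hj | hj
  · rw [coord_monomial_lt φ ρ n f _ j hj, coord_tensor_ne (by omega)]
  · obtain ⟨i, rfl⟩ := Nat.exists_eq_add_of_le' hj
    rw [coord_monomial_add]
    by_cases h : i = k
    · subst h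
      rw [coord_tensor_self, coord_tensor_self]
    · rw [coord_tensor_ne h, coord_tensor_ne (by omega), map_zero]

theorem monomial_add (n : ℕ) (f g : C₀(X, ℂ)) :
    monomial φ ρ n (f + g) = monomial φ ρ n f + monomial φ ρ n g := by
  refine (monomial_ext φ ρ (fun ξ k => ?_) fun ξ k hk => ?_).symm
  · rw [add_apply, map_add, coord_monomial_add, coord_monomial_add, act_add, map_add, add_apply]
  · rw [add_apply, map_add, coord_monomial_lt _ _ _ _ _ _ hk, coord_monomial_lt _ _ _ _ _ _ hk,
      add_zero]

theorem monomial_smul (n : ℕ) (c : ℂ) (f : C₀(X, ℂ)) :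
    monomial φ ρ n (c • f) = c • monomial φ ρ n f := by
  refine (monomial_ext φ ρ (fun ξ k => ?_) fun ξ k hk => ?_).symm
  · rw [smul_apply, map_smul, coord_monomial_add, act_smul, map_smul, smul_apply]
  · rw [smul_apply, map_smul, coord_monomial_lt _ _ _ _ _ _ hk, smul_zero]

/-- The multiplication rule `Uⁿ f Uᵐ g = Uⁿ⁺ᵐ ((f ∘ φᵐ) g)`. -/
theorem monomial_mul (n m : ℕ) (f g : C₀(X, ℂ)) :
    monomial φ ρ n f * monomial φ ρ m g = monomial φ ρ (n + m) (act φ m f * g) := by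
  refine monomial_ext φ ρ (fun ξ k => ?_) fun ξ k hk => ?_
  · rw [mul_apply_eq_comp, show k + (n + m) = (k + m) + n by omega,
      coord_monomial_add, coord_monomial_add, act_mul, act_act, map_mul,
      mul_apply_eq_comp]
  · rw [mul_apply_eq_comp]
    rcases lt_or_ge k n with h | h
    · exact coord_monomial_lt _ _ _ _ _ _ h
    · obtain ⟨j, rfl⟩ := Nat.exists_eq_add_of_le' h
      rw [coord_monomial_add, coord_monomial_lt _ _ _ _ _ _ (by omega), map_zero]

theorem norm_monomial_le (n : ℕ) (f : C₀(X, ℂ)) : ‖monomial φ ρ n f‖ ≤ ‖f‖ := by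
  refine ContinuousLinearMap.opNorm_le_bound _ (norm_nonneg _) fun ξ => ?_
  have h : ‖diag φ ρ f ξ‖ ≤ ‖f‖ * ‖ξ‖ :=
    (diag φ ρ f).le_of_opNorm_le (LinearMap.mkContinuous_norm_le _ (norm_nonneg _) _) ξ
  refine le_trans ?_ h
  rw [monomial, mul_apply_eq_comp]
  generalize diag φ ρ f ξ = η
  induction n with
  | zero => simp
  | succ n ih =>
    rw [pow_succ', mul_apply_eq_comp]
    exact (norm_shift_apply_le _).trans ih

variable (X) in
/-- The Banach space `ℓ¹(ℤ₊, C₀(X))`; the sequence `a` stands for the series `∑ Uⁿ aₙ`. -/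
abbrev Ell1 : Type u := lp (fun _ : ℕ => C₀(X, ℂ)) 1

theorem summable_norm (a : Ell1 X) : Summable fun n => ‖a n‖ := by
  simpa using (lp.memℓp a).summable (by simp)

theorem summable_monomial (a : Ell1 X) : Summable fun n => monomial φ ρ n (a n) :=
  Summable.of_norm_bounded (summable_norm a) fun n => norm_monomial_le φ ρ n (a n)

/-- The representation `π` of `ℓ¹(ℤ₊, C₀(X))` on `H₀ ⊗ ℓ²(ℤ₊)`, `π(∑ Uⁿ aₙ) = ∑ π(Uⁿ aₙ)`
(an absolutely convergent series of operators). -/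
def rep : Ell1 X →ₗ[ℂ] (HSpace H₀ →L[ℂ] HSpace H₀) where
  toFun a := ∑' n, monomial φ ρ n (a n)
  map_add' a b := by
    rw [← (summable_monomial φ ρ a).tsum_add (summable_monomial φ ρ b)]
    exact tsum_congr fun n => monomial_add φ ρ n (a n) (b n)
  map_smul' c a := by
    rw [RingHom.id_apply, ← (summable_monomial φ ρ a).tsum_const_smul c]
    exact tsum_congr fun n => monomial_smul φ ρ n c (a n)

theorem rep_apply (a : Ell1 X) : rep φ ρ a = ∑' n, monomial φ ρ n (a n) := rfl

theorem rep_single (n : ℕ) (f : C₀(X, ℂ)) :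
    rep φ ρ (lp.single 1 n f) = monomial φ ρ n f := by
  rw [rep_apply, tsum_eq_single n, lp.single_apply_self]
  intro k hk
  rw [lp.single_apply_ne _ _ _ hk]
  simpa using monomial_smul φ ρ k 0 0

theorem norm_rep_le (a : Ell1 X) : ‖rep φ ρ a‖ ≤ ‖a‖ := by
  have h : ‖a‖ = ∑' n, ‖a n‖ := by
    simpa using lp.norm_rpow_eq_tsum (p := 1) (by simp) a
  rw [h]
  exact tsum_of_norm_bounded (summable_norm a).hasSum fun n => norm_monomial_le φ ρ n (a n)

theorem rep_mul_rep_mem (a b : Ell1 X) :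
    rep φ ρ a * rep φ ρ b ∈ (LinearMap.range (rep φ ρ)).topologicalClosure := by
  have hc : IsClosed ((LinearMap.range (rep φ ρ)).topologicalClosure :
      Set (HSpace H₀ →L[ℂ] HSpace H₀)) := Submodule.isClosed_topologicalClosure _
  have key : ∀ {u : ℕ → (HSpace H₀ →L[ℂ] HSpace H₀)}, Summable u →
      (∀ n, u n ∈ (LinearMap.range (rep φ ρ)).topologicalClosure) →
      ∑' n, u n ∈ (LinearMap.range (rep φ ρ)).topologicalClosure := fun hs hu =>
    hc.mem_of_tendsto hs.hasSum (Filter.Eventually.of_forall fun s =>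
      Submodule.sum_mem _ fun i _ => hu i)
  rw [rep_apply φ ρ a, ← (summable_monomial φ ρ a).tsum_mul_right]
  refine key ((summable_monomial φ ρ a).mul_right _) fun n => ?_
  rw [rep_apply φ ρ b, ← (summable_monomial φ ρ b).tsum_mul_left]
  refine key ((summable_monomial φ ρ b).mul_left _) fun m => ?_
  rw [monomial_mul, ← rep_single]
  exact Submodule.le_topologicalClosure _ (LinearMap.mem_range_self _ _)

/-- The semicrossed product `C₀(X) ×_φ ℤ₊`: the norm closure of `π(ℓ¹(ℤ₊, C₀(X)))` in the algebra
of bounded operators on `H₀ ⊗ ℓ²(ℤ₊)`. -/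
def semicrossedProduct : Submodule ℂ (HSpace H₀ →L[ℂ] HSpace H₀) :=
  (LinearMap.range (rep φ ρ)).topologicalClosure

/-- The semicrossed product is closed under composition of operators, so it is an algebra. -/
theorem mul_mem_semicrossedProduct {S T : HSpace H₀ →L[ℂ] HSpace H₀}
    (hS : S ∈ semicrossedProduct φ ρ) (hT : T ∈ semicrossedProduct φ ρ) :
    S * T ∈ semicrossedProduct φ ρ := by
  have hc : IsClosed ((LinearMap.range (rep φ ρ)).topologicalClosure :
      Set (HSpace H₀ →L[ℂ] HSpace H₀)) := Submodule.isClosed_topologicalClosure _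
  have h := map_mem_closure₂ (u := ((LinearMap.range (rep φ ρ)).topologicalClosure :
      Set (HSpace H₀ →L[ℂ] HSpace H₀))) (f := fun S T => S * T)
    continuous_mul hS hT (by
      rintro _ ⟨a, rfl⟩ _ ⟨b, rfl⟩
      exact rep_mul_rep_mem φ ρ a b)
  rwa [hc.closure_eq] at h

theorem coe_semicrossedProduct :
    (semicrossedProduct φ ρ : Set (HSpace H₀ →L[ℂ] HSpace H₀)) = closure (Set.range (rep φ ρ)) :=
  rfl

theorem rep_mem (a : Ell1 X) : rep φ ρ a ∈ semicrossedProduct φ ρ :=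
  subset_closure (Set.mem_range_self a)

/-- The representation `π`, with values in the semicrossed product. -/
def repIn : Ell1 X →ₗ[ℂ] semicrossedProduct φ ρ where
  toFun a := ⟨rep φ ρ a, rep_mem φ ρ a⟩
  map_add' a b := Subtype.ext (map_add (rep φ ρ) a b)
  map_smul' c a := Subtype.ext (map_smul (rep φ ρ) c a)

theorem denseRange_repIn : DenseRange (repIn φ ρ) := by
  intro T
  rw [closure_subtype]
  have h : ((↑) '' Set.range (repIn φ ρ) : Set (HSpace H₀ →L[ℂ] HSpace H₀))
      = Set.range (rep φ ρ) := by
    rw [← Set.range_comp]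
    rfl
  rw [h]
  exact T.2

variable (X) in
/-- The Fourier coefficient `∑ Uᵏ aₖ ↦ aₙ` on `ℓ¹(ℤ₊, C₀(X))`. -/
def coeffEll1 (n : ℕ) : Ell1 X →ₗ[ℂ] C₀(X, ℂ) where
  toFun a := a n
  map_add' _ _ := rfl
  map_smul' _ _ := rfl

/-- The Fourier coefficient map `Eₙ` on the semicrossed product: the continuous extension of
`∑ Uᵏ aₖ ↦ aₙ` from the dense subspace `π(ℓ¹(ℤ₊, C₀(X)))`. -/
def fourierCoeff (n : ℕ) : semicrossedProduct φ ρ →L[ℂ] C₀(X, ℂ) :=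
  (coeffEll1 X n).extendOfNorm (repIn φ ρ)

theorem coord_rep_tensor_zero (a : Ell1 X) (ξ : H₀) (n : ℕ) :
    coord n (rep φ ρ a (tensor 0 ξ)) = ρ (a n) ξ := by
  let L : (HSpace H₀ →L[ℂ] HSpace H₀) →L[ℂ] H₀ :=
    (coord n).comp (ContinuousLinearMap.apply ℂ (HSpace H₀) (tensor 0 ξ))
  have h : L (rep φ ρ a) = ∑' k, L (monomial φ ρ k (a k)) := by
    rw [rep_apply, L.map_tsum (summable_monomial φ ρ a)]
  have hL : ∀ T, L T = coord n (T (tensor 0 ξ)) := fun _ => rfl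
  rw [← hL, h, tsum_eq_single n]
  · rw [hL, monomial_tensor, Nat.zero_add, coord_tensor_self, act_zero]
  · intro k hk
    rw [hL, monomial_tensor, coord_tensor_ne (by omega)]

variable {ρ}

/-- For a faithful `ρ`, the Fourier coefficients on `ℓ¹(ℤ₊, C₀(X))` are contractive for the
operator norm. -/
theorem norm_coeffEll1_le (hρ : Function.Injective ρ) (n : ℕ) (a : Ell1 X) :
    ‖coeffEll1 X n a‖ ≤ 1 * ‖repIn φ ρ a‖ := by
  rw [one_mul, ← NonUnitalStarAlgHom.norm_map ρ hρ]
  refine ContinuousLinearMap.opNorm_le_bound _ (norm_nonneg _) fun ξ => ?_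
  calc ‖ρ (coeffEll1 X n a) ξ‖ = ‖coord n (rep φ ρ a (tensor 0 ξ))‖ := by
        rw [coord_rep_tensor_zero]; rfl
    _ ≤ ‖rep φ ρ a (tensor 0 ξ)‖ := norm_coord_le n _
    _ ≤ ‖rep φ ρ a‖ * ‖tensor 0 ξ‖ := ContinuousLinearMap.le_opNorm _ _
    _ = ‖repIn φ ρ a‖ * ‖ξ‖ := by rw [norm_tensor]; rfl

/-- For a faithful `ρ`, the map `Eₙ` does extend the `n`-th coefficient. -/
theorem fourierCoeff_repIn (hρ : Function.Injective ρ) (n : ℕ) (a : Ell1 X) :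
    fourierCoeff φ ρ n (repIn φ ρ a) = a n :=
  LinearMap.extendOfNorm_eq (denseRange_repIn φ ρ) ⟨1, norm_coeffEll1_le φ hρ n⟩ a

/-- For a faithful `ρ`, the map `Eₙ` is a contraction. -/
theorem norm_fourierCoeff_le (hρ : Function.Injective ρ) (n : ℕ) (T : semicrossedProduct φ ρ) :
    ‖fourierCoeff φ ρ n T‖ ≤ ‖T‖ :=
  (LinearMap.norm_extendOfNorm_apply_le (denseRange_repIn φ ρ) 1
    (norm_coeffEll1_le φ hρ n) T).trans_eq (one_mul _)

variable (ρ)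

/-- The multiplication operator `M_{A,B} : T ↦ A T B` on the semicrossed product. -/
def multiplicationOperator (A B : semicrossedProduct φ ρ) :
    semicrossedProduct φ ρ →L[ℂ] semicrossedProduct φ ρ :=
  ((ContinuousLinearMap.mulLeftRight ℂ (HSpace H₀ →L[ℂ] HSpace H₀) A B).comp
    (semicrossedProduct φ ρ).subtypeL).codRestrict (semicrossedProduct φ ρ) fun T =>
      mul_mem_semicrossedProduct φ ρ (mul_mem_semicrossedProduct φ ρ A.2 T.2) B.2

theorem coe_multiplicationOperator_apply (A B T : semicrossedProduct φ ρ) :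
    (multiplicationOperator φ ρ A B T : HSpace H₀ →L[ℂ] HSpace H₀) = A * T * B := rfl

end Representation

section Points

variable (X : Type u) [TopologicalSpace X]

/-- The set `X_a` of accumulation points of `X`. -/
def accumulationPoints : Set X := {x | AccPt x (Filter.principal Set.univ)}

/-- The set `X_i` of isolated points of `X`. -/
def isolatedPoints : Set X := {x | IsOpen {x}}

end Points

end Semicrossed

end

/-! Write `f_a = E_a(A)` and `g_b = E_b(B)`. Everything rests on the identity `E_{l+M}(A Uˡh B) =
∑_{a+b=M} (f_a ∘ φ^{l+b}) (h ∘ φᵇ) g_b` (`fourierCoeff_multiplicationOperator_monomialIn`) and on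
the fact that the condition on `M_{A,B}` amounts to (a) together with uniform convergence `(f_m ∘
φ^{n+l}) g_n → 0` on `X` as `l → ∞`.

Necessity. If `M_{A,B}` is compact, all `A Uˡh B` with `‖h‖ ≤ 1` lie in one compact set. The maps
`E_k` are contractions tending to zero pointwise, hence uniformly on that set, so `E_{l+M}(A Uˡh B)
→ 0` uniformly in `h`. Testing with `h` concentrated at `φⁿ x` keeps the terms with `φᵇ x = φⁿ x`.
For isolated `x` the point mass itself is allowed. For an accumulation point it is approximated by
bumps: compactness makes the limit a continuous function that vanishes on a punctured neighbourhood
of `x`, hence at `x`. When `x` is periodic several `b` survive, but the surviving sum is a Cauchy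
product, which `tendsto_zero_of_antidiagonal` unravels. A separate look at periodic and non-periodic
isolated points makes the convergence uniform in `x`, which gives (c).

Sufficiency. Abel means, contractive by gauge invariance and the maximum principle, put `A` in the
closed span of its terms `Uᵐ f_m`, and likewise `B`. Since compactness is a closed linear condition
in each of `A` and `B`, monomials suffice. For these, (a)–(c) give uniform decay of `(f ∘ φ^{n+l})
g`. After soft thresholding of `f` and `g` the product vanishes for all large `l`, so the operator
is a finite sum of compact ones built from `h ↦ k · (h ∘ φⁿ)` with `k` zero at accumulation points.
-/

open Filter Topology

noncomputable section

namespace Semicrossed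

universe u v

/-! ### Equicontinuous sequences and Cauchy products. -/

section General

/-- An equicontinuous sequence tending to zero pointwise tends to zero uniformly on compact sets. -/
theorem eventually_forall_norm_lt_of_equicontinuous {Y E : Type*} [TopologicalSpace Y]
    [SeminormedAddCommGroup E] {F : ℕ → Y → E} (hF : Equicontinuous F)
    (h0 : ∀ y, Tendsto (fun l => F l y) atTop (𝓝 0)) {K : Set Y} (hK : IsCompact K)
    {ε : ℝ} (hε : 0 < ε) : ∀ᶠ l in atTop, ∀ y ∈ K, ‖F l y‖ < ε := by
  refine hK.induction_on (by simp) (fun s t hst ht => ht.mono fun l h y hy => h y (hst hy))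
    (fun s t hs ht => ?_) fun y _ => ?_
  · filter_upwards [hs, ht] with l h₁ h₂ y hy
    exact hy.elim (h₁ y) (h₂ y)
  · refine ⟨{z | ∀ l, dist (F l y) (F l z) < ε / 2}, mem_nhdsWithin_of_mem_nhds
      (Metric.equicontinuousAt_iff_right.1 (hF y) _ (half_pos hε)), ?_⟩
    filter_upwards [(Metric.tendsto_nhds.1 (h0 y)) _ (half_pos hε)] with l hl z hz
    rw [dist_zero_right] at hl
    have hz' := hz l
    rw [dist_eq_norm, norm_sub_rev] at hz'
    calc ‖F l z‖ = ‖(F l z - F l y) + F l y‖ := by rw [sub_add_cancel]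
      _ ≤ ‖F l z - F l y‖ + ‖F l y‖ := norm_add_le _ _
      _ < ε := by linarith

/-- If all Cauchy product coefficients of `∑ uₐ zᵃ` and `∑ v_b zᵇ` tend to zero, where the second
series is constant and nonzero, then so do all `uₐ`. -/
theorem tendsto_zero_of_antidiagonal {ι : Type*} {F : Filter ι} {w : ℕ → ι → ℂ} {v : ℕ → ℂ}
    (h : ∀ M, Tendsto (fun i => ∑ p ∈ Finset.HasAntidiagonal.antidiagonal M, w p.1 i * v p.2) F (𝓝 0))
    {n : ℕ} (hn : v n ≠ 0) (m : ℕ) : Tendsto (w m) F (𝓝 0) := by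
  classical
  have hex : ∃ b, v b ≠ 0 := ⟨n, hn⟩
  -- With `b₀` the first index where `v` is nonzero, the coefficient of order `m + b₀` is
  -- triangular: terms with first index below `m` tend to zero by induction, and those above `m`
  -- carry a factor `v b` with `b < b₀`.
  obtain ⟨b₀, hb₀, hmin⟩ : ∃ b₀, v b₀ ≠ 0 ∧ ∀ b < b₀, v b = 0 :=
    ⟨Nat.find hex, Nat.find_spec hex, fun b hb => not_not.1 (Nat.find_min hex hb)⟩
  induction m using Nat.strong_induction_on with
  | _ m ih =>
    have hmem : (m, b₀) ∈ Finset.HasAntidiagonal.antidiagonal (m + b₀) := by simp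
    have hrest : Tendsto (fun i => ∑ p ∈ (Finset.HasAntidiagonal.antidiagonal (m + b₀)).erase (m, b₀),
        w p.1 i * v p.2) F (𝓝 0) := by
      rw [← Finset.sum_const_zero (s := (Finset.HasAntidiagonal.antidiagonal (m + b₀)).erase (m, b₀))]
      refine tendsto_finsetSum _ fun p hp => ?_
      rw [Finset.mem_erase, Finset.HasAntidiagonal.mem_antidiagonal] at hp
      obtain ⟨hne, hsum⟩ := hp
      rcases lt_trichotomy p.1 m with hlt | heq | hgt
      · simpa using (ih p.1 hlt).mul_const (v p.2)
      · exact absurd (Prod.ext heq (by simp only; omega)) hne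
      · simpa [hmin p.2 (by omega)] using tendsto_const_nhds
    have hlim := (h (m + b₀)).sub hrest
    simp only [← Finset.add_sum_erase _ _ hmem, add_sub_cancel_right, sub_zero] at hlim
    simpa [hb₀] using hlim.mul_const (v b₀)⁻¹

end General

/-! ### Monomials, density arguments and Fourier coefficients of `A T B`. -/

section Product

variable {X : Type u} [TopologicalSpace X]
  {H₀ : Type v} [NormedAddCommGroup H₀] [InnerProductSpace ℂ H₀] [CompleteSpace H₀]
  (φ : X ≃ₜ X) (ρ : C₀(X, ℂ) →⋆ₙₐ[ℂ] (H₀ →L[ℂ] H₀))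

instance : CompleteSpace (semicrossedProduct φ ρ) :=
  inferInstanceAs (CompleteSpace (LinearMap.range (rep φ ρ)).topologicalClosure)

/-- The map `f ↦ Uⁿ f` into the semicrossed product. -/
def monomialIn (n : ℕ) : C₀(X, ℂ) →L[ℂ] semicrossedProduct φ ρ :=
  LinearMap.mkContinuous
    { toFun := fun f => ⟨monomial φ ρ n f, rep_single φ ρ n f ▸ rep_mem φ ρ _⟩
      map_add' := fun f g => Subtype.ext (monomial_add φ ρ n f g)
      map_smul' := fun c f => Subtype.ext (monomial_smul φ ρ n c f) }
    1 fun f => (norm_monomial_le φ ρ n f).trans_eq (one_mul _).symm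

@[simp] theorem coe_monomialIn (n : ℕ) (f : C₀(X, ℂ)) :
    (monomialIn φ ρ n f : HSpace H₀ →L[ℂ] HSpace H₀) = monomial φ ρ n f := rfl

theorem monomialIn_eq_repIn (n : ℕ) (f : C₀(X, ℂ)) :
    monomialIn φ ρ n f = repIn φ ρ (lp.single 1 n f) :=
  Subtype.ext (rep_single φ ρ n f).symm

theorem norm_monomialIn_le (n : ℕ) (f : C₀(X, ℂ)) : ‖monomialIn φ ρ n f‖ ≤ ‖f‖ :=
  norm_monomial_le φ ρ n f

variable {φ ρ}

/-- A closed property that holds for all polynomials `∑_{k<D} Uᵏ aₖ` holds on the whole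
semicrossed product. -/
theorem polynomial_induction {p : semicrossedProduct φ ρ → Prop} (hc : IsClosed {T | p T})
    (hp : ∀ (D : ℕ) (a : ℕ → C₀(X, ℂ)), p (∑ k ∈ Finset.range D, monomialIn φ ρ k (a k)))
    (T : semicrossedProduct φ ρ) : p T := by
  refine (denseRange_repIn φ ρ).induction_on T hc fun a => ?_
  have hs : HasSum (fun k => monomialIn φ ρ k (a k)) (repIn φ ρ a) := by
    have := (summable_monomial φ ρ a).hasSum
    rw [← rep_apply] at this
    exact (Topology.IsInducing.subtypeVal.hasSum_iff (g := (semicrossedProduct φ ρ).subtype)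
      (fun k => monomialIn φ ρ k (a k)) (repIn φ ρ a)).1 this
  exact hc.mem_of_tendsto hs.tendsto_sum_nat (Eventually.of_forall fun D => hp D _)

/-- A closed additive property that holds for all monomials `Uᵏ a` holds on the whole semicrossed
product. -/
theorem monomial_induction {p : semicrossedProduct φ ρ → Prop} (hc : IsClosed {T | p T})
    (hadd : ∀ S T, p S → p T → p (S + T)) (hm : ∀ k a, p (monomialIn φ ρ k a))
    (T : semicrossedProduct φ ρ) : p T := by
  refine polynomial_induction hc (fun D a => ?_) T
  exact Finset.sum_induction _ p hadd (by simpa using hm 0 0) fun k _ => hm k _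

theorem fourierCoeff_monomialIn (hρ : Function.Injective ρ) (n k : ℕ) (f : C₀(X, ℂ)) :
    fourierCoeff φ ρ n (monomialIn φ ρ k f) = if n = k then f else 0 := by
  rw [monomialIn_eq_repIn, fourierCoeff_repIn φ hρ]
  split_ifs with h
  · subst h
    exact lp.single_apply_self _ _ _
  · exact lp.single_apply_ne _ _ _ h

theorem multiplicationOperator_add_left (A A' B : semicrossedProduct φ ρ) :
    multiplicationOperator φ ρ (A + A') B =
      multiplicationOperator φ ρ A B + multiplicationOperator φ ρ A' B :=
  ContinuousLinearMap.ext fun T => Subtype.ext (by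
    simp [coe_multiplicationOperator_apply, add_mul])

theorem multiplicationOperator_add_right (A B B' : semicrossedProduct φ ρ) :
    multiplicationOperator φ ρ A (B + B') =
      multiplicationOperator φ ρ A B + multiplicationOperator φ ρ A B' :=
  ContinuousLinearMap.ext fun T => Subtype.ext (by
    simp [coe_multiplicationOperator_apply, mul_add])

theorem multiplicationOperator_smul_left (c : ℂ) (A B : semicrossedProduct φ ρ) :
    multiplicationOperator φ ρ (c • A) B = c • multiplicationOperator φ ρ A B :=
  ContinuousLinearMap.ext fun T => Subtype.ext (by
    simp [coe_multiplicationOperator_apply])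

theorem multiplicationOperator_smul_right (c : ℂ) (A B : semicrossedProduct φ ρ) :
    multiplicationOperator φ ρ A (c • B) = c • multiplicationOperator φ ρ A B :=
  ContinuousLinearMap.ext fun T => Subtype.ext (by
    simp [coe_multiplicationOperator_apply])

theorem norm_multiplicationOperator_le (A B : semicrossedProduct φ ρ) :
    ‖multiplicationOperator φ ρ A B‖ ≤ ‖A‖ * ‖B‖ := by
  refine ContinuousLinearMap.opNorm_le_bound _ (by positivity) fun T => ?_
  calc ‖multiplicationOperator φ ρ A B T‖
      = ‖(A : HSpace H₀ →L[ℂ] HSpace H₀) * T * B‖ := rfl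
    _ ≤ ‖A‖ * ‖T‖ * ‖B‖ := (norm_mul_le _ _).trans
        (mul_le_mul_of_nonneg_right (norm_mul_le _ _) (norm_nonneg _))
    _ = ‖A‖ * ‖B‖ * ‖T‖ := by ring

theorem continuous_multiplicationOperator_left (B : semicrossedProduct φ ρ) :
    Continuous fun A => multiplicationOperator φ ρ A B := by
  suffices LipschitzWith ‖B‖₊ fun A => multiplicationOperator φ ρ A B from this.continuous
  refine LipschitzWith.of_dist_le_mul fun A A' => ?_
  have h : multiplicationOperator φ ρ A B - multiplicationOperator φ ρ A' B =
      multiplicationOperator φ ρ (A - A') B := ContinuousLinearMap.ext fun T => Subtype.ext (by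
    simp [coe_multiplicationOperator_apply, sub_mul])
  rw [dist_eq_norm, dist_eq_norm, h, mul_comm]
  exact norm_multiplicationOperator_le _ _

theorem continuous_multiplicationOperator_right (A : semicrossedProduct φ ρ) :
    Continuous fun B => multiplicationOperator φ ρ A B := by
  suffices LipschitzWith ‖A‖₊ fun B => multiplicationOperator φ ρ A B from this.continuous
  refine LipschitzWith.of_dist_le_mul fun B B' => ?_
  have h : multiplicationOperator φ ρ A B - multiplicationOperator φ ρ A B' =
      multiplicationOperator φ ρ A (B - B') := ContinuousLinearMap.ext fun T => Subtype.ext (by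
    simp [coe_multiplicationOperator_apply, mul_sub])
  rw [dist_eq_norm, dist_eq_norm, h]
  exact norm_multiplicationOperator_le _ _

theorem multiplicationOperator_monomialIn (p l q : ℕ) (a h b : C₀(X, ℂ)) :
    multiplicationOperator φ ρ (monomialIn φ ρ p a) (monomialIn φ ρ q b) (monomialIn φ ρ l h) =
      monomialIn φ ρ (p + l + q) (act φ (l + q) a * act φ q h * b) := by
  refine Subtype.ext ?_
  rw [coe_multiplicationOperator_apply]
  simp only [coe_monomialIn, monomial_mul, act_mul, act_act, Nat.add_comm q l]

/-- The map `f ↦ f ∘ φⁿ` as a continuous linear map. -/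
def actL (φ : X ≃ₜ X) (n : ℕ) : C₀(X, ℂ) →L[ℂ] C₀(X, ℂ) :=
  LinearMap.mkContinuous
    { toFun := act φ n
      map_add' := act_add φ n
      map_smul' := act_smul φ n } 1 fun f => (norm_act_le φ n f).trans_eq (one_mul _).symm

@[simp] theorem actL_apply (n : ℕ) (f : C₀(X, ℂ)) : actL φ n f = act φ n f := rfl

theorem continuous_act (n : ℕ) : Continuous (act φ n) := (actL φ n).continuous

/-- The Fourier coefficients of `A Uˡh B`. -/
theorem fourierCoeff_multiplicationOperator_monomialIn (hρ : Function.Injective ρ) (l M : ℕ)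
    (h : C₀(X, ℂ)) (A B : semicrossedProduct φ ρ) :
    fourierCoeff φ ρ (l + M) (multiplicationOperator φ ρ A B (monomialIn φ ρ l h)) =
      ∑ p ∈ Finset.HasAntidiagonal.antidiagonal M, act φ (l + p.2) (fourierCoeff φ ρ p.1 A) * act φ p.2 h *
        fourierCoeff φ ρ p.2 B := by
  have hcA : ∀ B, Continuous fun A => multiplicationOperator φ ρ A B (monomialIn φ ρ l h) :=
    fun B => (continuous_multiplicationOperator_left B).clm_apply continuous_const
  have hcB : ∀ A, Continuous fun B => multiplicationOperator φ ρ A B (monomialIn φ ρ l h) :=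
    fun A => (continuous_multiplicationOperator_right A).clm_apply continuous_const
  have hcE : ∀ n, Continuous (fourierCoeff φ ρ n) := fun n => (fourierCoeff φ ρ n).continuous
  -- Both sides are additive and continuous in `A` and in `B`, so it is enough to compare them on
  -- monomials, where at most one term of the sum survives.
  revert A
  refine monomial_induction (isClosed_eq ((hcE _).comp (hcA B)) (continuous_finsetSum _ fun p _ =>
    (((continuous_act _).comp (hcE _)).mul continuous_const).mul continuous_const)) ?_ ?_
  · intro A A' h₁ h₂
    rw [multiplicationOperator_add_left, add_apply, map_add, h₁, h₂,
      ← Finset.sum_add_distrib]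
    refine Finset.sum_congr rfl fun p _ => ?_
    rw [map_add, act_add, add_mul, add_mul]
  intro i a
  revert B
  refine monomial_induction (isClosed_eq ((hcE _).comp (hcB _)) (continuous_finsetSum _ fun p _ =>
    continuous_const.mul (hcE _))) ?_ ?_
  · intro B B' h₁ h₂
    rw [multiplicationOperator_add_right, add_apply, map_add, h₁, h₂,
      ← Finset.sum_add_distrib]
    refine Finset.sum_congr rfl fun p _ => ?_
    rw [map_add, mul_add]
  intro j b
  have hact0 : ∀ k, act φ k (0 : C₀(X, ℂ)) = 0 := fun k => map_zero (actL φ k)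
  rw [multiplicationOperator_monomialIn, fourierCoeff_monomialIn hρ]
  simp only [fourierCoeff_monomialIn hρ]
  by_cases hM : i + j = M
  · rw [if_pos (by omega), Finset.sum_eq_single (i, j)]
    · simp
    · rintro ⟨i', j'⟩ hp hne
      rw [Finset.HasAntidiagonal.mem_antidiagonal] at hp
      simp only at hp ⊢
      have : i' ≠ i := fun he => hne (Prod.ext he (by simp only; omega))
      rw [if_neg this, hact0, zero_mul, zero_mul]
    · intro hn
      exact absurd (Finset.HasAntidiagonal.mem_antidiagonal.2 hM) hn
  · rw [if_neg (by omega)]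
    refine (Finset.sum_eq_zero fun p hp => ?_).symm
    rw [Finset.HasAntidiagonal.mem_antidiagonal] at hp
    by_cases h1 : p.1 = i
    · rw [if_neg (by omega : ¬ p.2 = j), mul_zero]
    · rw [if_neg h1, hact0, zero_mul, zero_mul]

/-- All `Eₙ` are contractions, so one modulus of continuity serves every `n`. -/
theorem equicontinuous_fourierCoeff (hρ : Function.Injective ρ) :
    Equicontinuous fun (n : ℕ) (T : semicrossedProduct φ ρ) => fourierCoeff φ ρ n T := by
  refine fun T => Metric.equicontinuousAt_iff_right.2 fun ε hε => ?_
  filter_upwards [Metric.ball_mem_nhds T hε] with T' hT' n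
  rw [dist_eq_norm, ← map_sub]
  refine (norm_fourierCoeff_le φ hρ n _).trans_lt ?_
  rwa [← dist_eq_norm, dist_comm]

/-- A Riemann–Lebesgue lemma: the Fourier coefficients tend to zero. -/
theorem tendsto_fourierCoeff (hρ : Function.Injective ρ) (T : semicrossedProduct φ ρ) :
    Tendsto (fun n => fourierCoeff φ ρ n T) atTop (𝓝 0) := by
  -- For an equicontinuous sequence the set of points of convergence is closed; on a monomial the
  -- coefficients are eventually zero.
  refine monomial_induction (p := fun T => Tendsto (fun n => fourierCoeff φ ρ n T) atTop (𝓝 0))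
    ((equicontinuous_fourierCoeff hρ).isClosed_setOfPred_tendsto continuous_const) ?_ ?_ T
  · intro S T hS hT
    simpa using hS.add hT
  · intro k a
    refine tendsto_const_nhds.congr' ?_
    filter_upwards [eventually_gt_atTop k] with n hn
    rw [fourierCoeff_monomialIn hρ, if_neg hn.ne']

end Product

/-! ### Functions concentrated at a point; isolated and accumulation points. -/

section Functions

variable {X : Type u} [TopologicalSpace X]

open Classical in
/-- The characteristic function of an isolated point. -/
def pointMass [T1Space X] (z : X) (hz : IsOpen {z}) : C₀(X, ℂ) where
  toFun x := if x = z then 1 else 0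
  continuous_toFun := by
    refine continuous_const.if (fun x hx => ?_) continuous_const
    change x ∈ frontier ({z} : Set X) at hx
    have hcl : IsClopen ({z} : Set X) := ⟨isClosed_singleton, hz⟩
    rw [hcl.frontier_eq] at hx
    exact hx.elim
  zero_at_infty' := by
    refine tendsto_const_nhds.congr' ?_
    filter_upwards [isCompact_singleton (x := z) |>.compl_mem_cocompact] with x hx
    exact (if_neg hx).symm

open Classical in
theorem pointMass_apply [T1Space X] (z : X) (hz : IsOpen {z}) (x : X) :
    pointMass z hz x = if x = z then 1 else 0 := rfl

theorem norm_pointMass_le [T1Space X] (z : X) (hz : IsOpen {z}) : ‖pointMass z hz‖ ≤ 1 :=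
  norm_le_of_forall zero_le_one fun x => by
    rw [pointMass_apply]
    split_ifs <;> simp

open Classical in
/-- The characteristic function of a point is a pointwise limit of functions in the unit ball. -/
theorem exists_seq_tendsto_indicator [LocallyCompactSpace X] [TopologicalSpace.MetrizableSpace X]
    (z : X) : ∃ h : ℕ → C₀(X, ℂ), (∀ i, ‖h i‖ ≤ 1) ∧
      ∀ w, Tendsto (fun i => h i w) atTop (𝓝 (if w = z then 1 else 0)) := by
  let := TopologicalSpace.metrizableSpaceMetric X
  -- In a metrizable space `{z}` is a Gδ, so `ψ` can be chosen to equal `1` at `z` only; its powers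
  -- then decrease to the indicator of `z`.
  obtain ⟨ψ, hψ1, -, hψc, hψI⟩ := exists_continuous_one_zero_of_isCompact_of_isGδ
    (isCompact_singleton (x := z)) (IsClosed.isGδ isClosed_singleton) isClosed_empty
    (Set.disjoint_empty _)
  -- The exponent `i + 1` keeps the powers zero off the support of `ψ`; exponent `0` would give the
  -- constant `1`.
  have hlim : ∀ i, Tendsto (fun w => ((ψ w : ℂ)) ^ (i + 1)) (cocompact X) (𝓝 0) := by
    intro i
    refine tendsto_const_nhds.congr' ?_
    filter_upwards [hψc.compl_mem_cocompact] with w hw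
    rw [image_eq_zero_of_notMem_tsupport hw]
    simp
  refine ⟨fun i => ⟨⟨fun w => (ψ w : ℂ) ^ (i + 1), by fun_prop⟩, hlim i⟩, fun i => ?_, fun w => ?_⟩
  · refine norm_le_of_forall zero_le_one fun w => ?_
    change ‖(ψ w : ℂ) ^ (i + 1)‖ ≤ 1
    rw [norm_pow, Complex.norm_real, Real.norm_of_nonneg (hψI w).1]
    exact pow_le_one₀ (hψI w).1 (hψI w).2
  · change Tendsto (fun i => (ψ w : ℂ) ^ (i + 1)) atTop _
    have hiff : w = z ↔ ψ w = 1 := by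
      rw [← Set.mem_singleton_iff, hψ1]
      rfl
    by_cases hw : w = z
    · rw [if_pos hw, hiff.1 hw]
      simp
    · rw [if_neg hw]
      refine (tendsto_pow_atTop_nhds_zero_of_norm_lt_one ?_).comp (tendsto_add_atTop_nat 1)
      rw [Complex.norm_real, Real.norm_of_nonneg (hψI w).1]
      exact lt_of_le_of_ne (hψI w).2 fun h => hw (hiff.2 h)

theorem isOpen_singleton_iterate (φ : X ≃ₜ X) {x : X} (hx : IsOpen {x}) (n : ℕ) :
    IsOpen {φ^[n] x} := by
  induction n with
  | zero => exact hx
  | succ n ih =>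
    rw [Function.iterate_succ_apply', ← Set.image_singleton]
    exact φ.isOpenMap _ ih

theorem isolated_or_accumulation (x : X) : IsOpen {x} ∨ x ∈ accumulationPoints X := by
  by_cases h : IsOpen {x}
  · exact Or.inl h
  · refine Or.inr ?_
    rw [accumulationPoints, Set.mem_ofPred_eq, AccPt, principal_univ, inf_top_eq]
    exact neBot_iff.2 fun hbot => h (isOpen_singleton_iff_punctured_nhds x |>.2 hbot)

theorem neBot_nhdsNE_of_mem_accumulationPoints {x : X} (hx : x ∈ accumulationPoints X) :
    (𝓝[≠] x).NeBot := by
  rwa [accumulationPoints, Set.mem_ofPred_eq, AccPt, principal_univ, inf_top_eq] at hx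

end Functions

/-! ### Compactness of `M_{A,B}` implies the three conditions. -/

section Necessity

variable {X : Type u} [TopologicalSpace X]
  {H₀ : Type v} [NormedAddCommGroup H₀] [InnerProductSpace ℂ H₀] [CompleteSpace H₀]
  {φ : X ≃ₜ X} {ρ : C₀(X, ℂ) →⋆ₙₐ[ℂ] (H₀ →L[ℂ] H₀)}
  {A B : semicrossedProduct φ ρ}

/-- The monomials `Uˡh` with `‖h‖ ≤ 1` lie in the unit ball whatever `l` is, so a single `K` serves
all of them. -/
theorem exists_isCompact_multiplicationOperator
    (hM : IsCompactOperator (multiplicationOperator φ ρ A B)) :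
    ∃ K : Set (semicrossedProduct φ ρ), IsCompact K ∧ ∀ (l : ℕ) (h : C₀(X, ℂ)), ‖h‖ ≤ 1 →
      multiplicationOperator φ ρ A B (monomialIn φ ρ l h) ∈ K := by
  obtain ⟨K, hK, hsub⟩ := IsCompactOperator.image_closedBall_subset_compact
    (f := (multiplicationOperator φ ρ A B).toLinearMap) hM 1
  refine ⟨K, hK, fun l h hh => hsub ⟨_, ?_, rfl⟩⟩
  rw [mem_closedBall_zero_iff]
  exact (norm_monomialIn_le φ ρ l h).trans hh

/-- Pointwise decay of the Fourier coefficients becomes uniform on a compact set by equicontinuity;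
this is what makes the bound independent of `h`. -/
theorem eventually_norm_fourierCoeff_lt (hρ : Function.Injective ρ)
    (hM : IsCompactOperator (multiplicationOperator φ ρ A B)) (M : ℕ) {ε : ℝ} (hε : 0 < ε) :
    ∀ᶠ l in atTop, ∀ h : C₀(X, ℂ), ‖h‖ ≤ 1 →
      ‖fourierCoeff φ ρ (l + M) (multiplicationOperator φ ρ A B (monomialIn φ ρ l h))‖ < ε := by
  obtain ⟨K, hK, hmem⟩ := exists_isCompact_multiplicationOperator hM
  have h := eventually_forall_norm_lt_of_equicontinuous (equicontinuous_fourierCoeff hρ)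
    (tendsto_fourierCoeff hρ) hK hε
  filter_upwards [(tendsto_add_atTop_nat M).eventually h] with l hl h hh
  exact hl _ (hmem l h hh)

theorem fourierCoeff_multiplicationOperator_monomialIn_apply (hρ : Function.Injective ρ) (l M : ℕ)
    (h : C₀(X, ℂ)) (x : X) :
    fourierCoeff φ ρ (l + M) (multiplicationOperator φ ρ A B (monomialIn φ ρ l h)) x =
      ∑ p ∈ Finset.HasAntidiagonal.antidiagonal M, fourierCoeff φ ρ p.1 A (φ^[l + p.2] x) *
        h (φ^[p.2] x) * fourierCoeff φ ρ p.2 B x := by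
  rw [fourierCoeff_multiplicationOperator_monomialIn hρ]
  let ev : C₀(X, ℂ) →+ ℂ :=
    { toFun := fun f => f x
      map_zero' := rfl
      map_add' := fun _ _ => rfl }
  exact map_sum ev _ _

open Classical in
/-- At an accumulation point, the terms that a bump at `φⁿ x` singles out sum to zero. -/
theorem sum_eq_zero_of_mem_accumulationPoints [LocallyCompactSpace X]
    [TopologicalSpace.MetrizableSpace X] (hρ : Function.Injective ρ)
    (hM : IsCompactOperator (multiplicationOperator φ ρ A B)) (l n M : ℕ) {x : X}
    (hx : x ∈ accumulationPoints X) :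
    ∑ p ∈ Finset.HasAntidiagonal.antidiagonal M, fourierCoeff φ ρ p.1 A (φ^[l + p.2] x) *
      (if φ^[p.2] x = φ^[n] x then 1 else 0) * fourierCoeff φ ρ p.2 B x = 0 := by
  obtain ⟨h, hh1, hh⟩ := exists_seq_tendsto_indicator (φ^[n] x)
  obtain ⟨K, hK, hmem⟩ := exists_isCompact_multiplicationOperator hM
  -- A norm limit along a subsequence forces the pointwise limit of the coefficients to be a
  -- continuous function `F`, although the indicator itself is not continuous.
  obtain ⟨T, -, s, hs, hT⟩ := hK.tendsto_subseq fun i => hmem l (h i) (hh1 i)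
  set F := fourierCoeff φ ρ (l + M) T with hF
  have hlim : ∀ y, F y = ∑ p ∈ Finset.HasAntidiagonal.antidiagonal M,
      fourierCoeff φ ρ p.1 A (φ^[l + p.2] y) * (if φ^[p.2] y = φ^[n] x then 1 else 0) *
        fourierCoeff φ ρ p.2 B y := by
    intro y
    have h1 : Tendsto (fun i => fourierCoeff φ ρ (l + M)
        (multiplicationOperator φ ρ A B (monomialIn φ ρ l (h (s i)))) y) atTop (𝓝 (F y)) := by
      rw [tendsto_iff_norm_sub_tendsto_zero]
      have h2 := tendsto_iff_norm_sub_tendsto_zero.1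
        (((fourierCoeff φ ρ (l + M)).continuous.tendsto T).comp hT)
      exact squeeze_zero (fun _ => norm_nonneg _) (fun i => norm_apply_le
        (fourierCoeff φ ρ (l + M)
          (multiplicationOperator φ ρ A B (monomialIn φ ρ l (h (s i)))) - F) y) h2
    refine tendsto_nhds_unique h1 ?_
    simp only [fourierCoeff_multiplicationOperator_monomialIn_apply hρ]
    exact tendsto_finsetSum _ fun p _ =>
      (((hh (φ^[p.2] y)).comp hs.tendsto_atTop).const_mul _).mul_const _
  rw [← hlim x]
  -- For `y ≠ x` near `x` no `φᵇ y` with `b ≤ M` equals `φⁿ x`: by injectivity if `φᵇ x = φⁿ x`, by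
  -- continuity otherwise.
  have hne : ∀ᶠ y in 𝓝[≠] x, F y = 0 := by
    have hev : ∀ᶠ y in 𝓝[≠] x, ∀ p ∈ Finset.HasAntidiagonal.antidiagonal M,
        φ^[p.2] y ≠ φ^[n] x := by
      rw [Filter.eventually_all_finset]
      intro p _
      by_cases hp : φ^[p.2] x = φ^[n] x
      · filter_upwards [self_mem_nhdsWithin] with y hy h
        exact hy ((φ.injective.iterate p.2) (h.trans hp.symm))
      · exact ((φ.continuous.iterate p.2).continuousAt.eventually_ne hp).filter_mono
          nhdsWithin_le_nhds
    filter_upwards [hev] with y hy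
    rw [hlim y]
    refine Finset.sum_eq_zero fun p hp => ?_
    rw [if_neg (hy p hp), mul_zero, zero_mul]
  have := neBot_nhdsNE_of_mem_accumulationPoints hx
  exact tendsto_nhds_unique ((F.continuous.tendsto x).mono_left nhdsWithin_le_nhds)
    (tendsto_const_nhds.congr' (hne.mono fun y hy => hy.symm))

/-- On a periodic orbit the bump at `φⁿ x` also sees other indices `b`; the Cauchy product structure
separates them. -/
theorem fourierCoeff_mul_eq_zero_of_mem_accumulationPoints [LocallyCompactSpace X]
    [TopologicalSpace.MetrizableSpace X] (hρ : Function.Injective ρ)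
    (hM : IsCompactOperator (multiplicationOperator φ ρ A B)) (m n l : ℕ) {x : X}
    (hx : x ∈ accumulationPoints X) :
    fourierCoeff φ ρ m A (φ^[n + l] x) * fourierCoeff φ ρ n B x = 0 := by
  classical
  by_cases hn : fourierCoeff φ ρ n B x = 0
  · rw [hn, mul_zero]
  -- Along the filter `pure ()` a limit statement about constants is an equality.
  have key := tendsto_zero_of_antidiagonal (F := (pure () : Filter Unit))
    (w := fun m _ => fourierCoeff φ ρ m A (φ^[l + n] x))
    (v := fun b => (if φ^[b] x = φ^[n] x then 1 else 0) * fourierCoeff φ ρ b B x) (fun M => ?_)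
    (n := n) (by simpa using hn) m
  · rw [Nat.add_comm n l, tendsto_nhds_unique tendsto_const_nhds key, zero_mul]
  · have h := sum_eq_zero_of_mem_accumulationPoints hρ hM l n M hx
    refine tendsto_const_nhds.congr fun _ => ?_
    refine h.symm.trans (Finset.sum_congr rfl fun p _ => ?_)
    by_cases hp : φ^[p.2] x = φ^[n] x
    -- On the surviving terms `f_a(φ^{l+b} x) = f_a(φ^{l+n} x)` no longer depends on `b`, which is
    -- why the sum is a Cauchy product.
    · rw [if_pos hp, Function.iterate_add_apply, hp, ← Function.iterate_add_apply, mul_assoc]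
    · simp [hp]

-- The test function is the point mass at `φⁿ x`. Its norm is at most `1` for every `x`, so the
-- threshold on `l` does not depend on `x`.
open Classical in
theorem eventually_norm_sum_lt_of_isolated [T1Space X] (hρ : Function.Injective ρ)
    (hM : IsCompactOperator (multiplicationOperator φ ρ A B)) (n M : ℕ) {ε : ℝ} (hε : 0 < ε) :
    ∀ᶠ l in atTop, ∀ x : X, IsOpen {x} →
      ‖∑ p ∈ Finset.HasAntidiagonal.antidiagonal M, fourierCoeff φ ρ p.1 A (φ^[l + p.2] x) *
        (if φ^[p.2] x = φ^[n] x then 1 else 0) * fourierCoeff φ ρ p.2 B x‖ < ε := by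
  filter_upwards [eventually_norm_fourierCoeff_lt hρ hM M hε] with l hl x hx
  have h := hl _ (norm_pointMass_le _ (isOpen_singleton_iterate φ hx n))
  refine (norm_apply_le _ x).trans_lt h |>.trans_eq' ?_
  rw [fourierCoeff_multiplicationOperator_monomialIn_apply hρ]
  rfl

theorem tendsto_fourierCoeff_mul_of_isolated [T1Space X] (hρ : Function.Injective ρ)
    (hM : IsCompactOperator (multiplicationOperator φ ρ A B)) (m n : ℕ) {x : X}
    (hx : IsOpen {x}) :
    Tendsto (fun l : ℕ => fourierCoeff φ ρ m A (φ^[n + l] x) * fourierCoeff φ ρ n B x) atTop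
      (𝓝 0) := by
  classical
  by_cases hn : fourierCoeff φ ρ n B x = 0
  · simp [hn]
  have key := tendsto_zero_of_antidiagonal (F := atTop)
    (w := fun m l => fourierCoeff φ ρ m A (φ^[n + l] x))
    (v := fun b => (if φ^[b] x = φ^[n] x then 1 else 0) * fourierCoeff φ ρ b B x) (fun M => ?_)
    (n := n) (by simpa using hn) m
  · simpa using key.mul_const (fourierCoeff φ ρ n B x)
  · rw [Metric.tendsto_nhds]
    intro ε hε
    filter_upwards [eventually_norm_sum_lt_of_isolated hρ hM n M hε] with l hl
    rw [dist_zero_right]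
    refine (hl x hx).trans_eq' (congrArg norm (Finset.sum_congr rfl fun p _ => ?_))
    by_cases hp : φ^[p.2] x = φ^[n] x
    · rw [if_pos hp, Function.iterate_add_apply, hp, ← Function.iterate_add_apply, mul_assoc,
        Nat.add_comm l n]
    · simp [hp]

/-- This uniform decay is the source of condition (c). The product is exactly zero at accumulation
points and, for every `l`, at periodic isolated points; at the remaining points the test sum reduces
to a single term. -/
theorem eventually_norm_fourierCoeff_mul_lt [LocallyCompactSpace X]
    [TopologicalSpace.MetrizableSpace X] (hρ : Function.Injective ρ)
    (hM : IsCompactOperator (multiplicationOperator φ ρ A B)) (m n : ℕ) {ε : ℝ} (hε : 0 < ε) :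
    ∀ᶠ l in atTop, ∀ x,
      ‖fourierCoeff φ ρ m A (φ^[n + l] x) * fourierCoeff φ ρ n B x‖ < ε := by
  classical
  -- Order `m + n` is the one whose antidiagonal contains `(m, n)`.
  filter_upwards [eventually_norm_sum_lt_of_isolated hρ hM n (m + n) hε] with l hl x
  rcases isolated_or_accumulation x with hx | hx
  swap
  · rwa [fourierCoeff_mul_eq_zero_of_mem_accumulationPoints hρ hM m n l hx, norm_zero]
  by_cases hper : ∃ q > 0, φ^[q] x = x
  · obtain ⟨q, hq, hqx⟩ := hper
    -- Along `l + qk`, with `q` a period of `x`, the sequence is constant and tends to zero, so its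
    -- value is zero.
    have h := (tendsto_fourierCoeff_mul_of_isolated hρ hM m n hx).comp
      ((tendsto_add_atTop_nat l).comp (tendsto_id.nsmul_atTop hq))
    have hconst : ∀ k : ℕ, φ^[n + (q * k + l)] x = φ^[n + l] x := fun k => by
      rw [show n + (q * k + l) = (n + l) + q * k by ring, Function.iterate_add_apply,
        Function.iterate_mul, Function.iterate_fixed hqx]
    have hlim : Tendsto (fun _ : ℕ => fourierCoeff φ ρ m A (φ^[n + l] x) *
        fourierCoeff φ ρ n B x) atTop (𝓝 0) := h.congr fun k => by
      simp only [Function.comp_apply, smul_eq_mul, id, hconst]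
    rwa [← tendsto_nhds_unique hlim tendsto_const_nhds, norm_zero]
  · have hinj : ∀ b, φ^[b] x = φ^[n] x → b = n := by
      intro b hb
      by_contra hne
      rcases lt_or_gt_of_ne hne with hlt | hlt
      · refine hper ⟨n - b, by omega, (φ.injective.iterate b) ?_⟩
        rw [← Function.iterate_add_apply, Nat.add_sub_cancel' hlt.le, hb]
      · refine hper ⟨b - n, by omega, (φ.injective.iterate n) ?_⟩
        rw [← Function.iterate_add_apply, Nat.add_sub_cancel' hlt.le, hb]
    have h := hl x hx
    rw [Finset.sum_eq_single (m, n)] at h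
    · simpa [Nat.add_comm l n] using h
    · rintro ⟨a, b⟩ hp hne
      rw [Finset.HasAntidiagonal.mem_antidiagonal] at hp
      have : ¬ φ^[b] x = φ^[n] x := fun hb => hne (by
        have := hinj b hb
        exact Prod.ext (by simp only at hp ⊢; omega) this)
      simp [this]
    · intro hn
      exact absurd (by simp) hn

/-- A sequence of continuous functions that tends to zero uniformly is equicontinuous. -/
theorem equicontinuous_of_eventually_norm_lt {E : Type*} [SeminormedAddCommGroup E]
    {F : ℕ → X → E} (hc : ∀ l, Continuous (F l))
    (h : ∀ ε > 0, ∀ᶠ l in atTop, ∀ x, ‖F l x‖ < ε) : Equicontinuous F := by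
  refine fun x => Metric.equicontinuousAt_iff_right.2 fun ε hε => ?_
  obtain ⟨L, hL⟩ := eventually_atTop.1 (h (ε / 2) (half_pos hε))
  have hfin : ∀ᶠ y in 𝓝 x, ∀ l ∈ Finset.range L, dist (F l x) (F l y) < ε := by
    rw [Filter.eventually_all_finset]
    intro l _
    filter_upwards [Metric.tendsto_nhds.1 ((hc l).tendsto x) ε hε] with y hy
    rwa [dist_comm]
  filter_upwards [hfin] with y hy l
  rcases lt_or_ge l L with hl | hl
  · exact hy l (Finset.mem_range.2 hl)
  · rw [dist_eq_norm]
    have := norm_sub_le (F l x) (F l y)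
    linarith [hL l hl x, hL l hl y]

end Necessity

/-! ### The gauge action and its extension to the closed disc. -/

section Gauge

variable {H₀ : Type v} [NormedAddCommGroup H₀] [InnerProductSpace ℂ H₀]

theorem norm_pow_smul_coord_le {z : ℂ} (hz : ‖z‖ ≤ 1) (ξ : HSpace H₀) (k : ℕ) :
    ‖z ^ k • coord k ξ‖ ^ 2 ≤ ‖coord k ξ‖ ^ 2 := by
  refine pow_le_pow_left₀ (norm_nonneg _) ?_ 2
  rw [norm_smul, norm_pow]
  exact mul_le_of_le_one_left (norm_nonneg _) (pow_le_one₀ (norm_nonneg _) hz)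

theorem summable_pow_smul_coord {z : ℂ} (hz : ‖z‖ ≤ 1) (ξ : HSpace H₀) :
    Summable fun k => ‖z ^ k • coord k ξ‖ ^ 2 :=
  Summable.of_nonneg_of_le (fun _ => by positivity) (norm_pow_smul_coord_le hz ξ) (summable_sq ξ)

/-- The operator `ξ ⊗ e_k ↦ zᵏ ξ ⊗ e_k`. -/
def gauge (z : ℂ) (hz : ‖z‖ ≤ 1) : HSpace H₀ →L[ℂ] HSpace H₀ :=
  LinearMap.mkContinuous
    { toFun := fun ξ => ofSeq (fun k => z ^ k • coord k ξ) (summable_pow_smul_coord hz ξ)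
      map_add' := fun ξ η => hspace_ext fun k => by simp
      map_smul' := fun c ξ => hspace_ext fun k => by simp [smul_comm c] }
    1 (fun ξ => norm_ofSeq_le (summable_pow_smul_coord hz ξ) zero_le_one (by
      rw [one_pow, one_mul]
      exact (summable_pow_smul_coord hz ξ).tsum_le_tsum (norm_pow_smul_coord_le hz ξ)
        (summable_sq ξ)))

@[simp] theorem coord_gauge (z : ℂ) (hz : ‖z‖ ≤ 1) (ξ : HSpace H₀) (k : ℕ) :
    coord k (gauge z hz ξ) = z ^ k • coord k ξ := rfl

theorem norm_gauge_le (z : ℂ) (hz : ‖z‖ ≤ 1) :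
    ‖(gauge z hz : HSpace H₀ →L[ℂ] HSpace H₀)‖ ≤ 1 :=
  LinearMap.mkContinuous_norm_le _ zero_le_one _

variable {X : Type u} [TopologicalSpace X] [CompleteSpace H₀]
  (φ : X ≃ₜ X) (ρ : C₀(X, ℂ) →⋆ₙₐ[ℂ] (H₀ →L[ℂ] H₀))

theorem gauge_mul_monomial_mul_gauge {z w : ℂ} (hz : ‖z‖ ≤ 1) (hw : ‖w‖ ≤ 1) (hzw : z * w = 1)
    (n : ℕ) (f : C₀(X, ℂ)) :
    gauge z hz * monomial φ ρ n f * gauge w hw = z ^ n • monomial φ ρ n f := by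
  rw [← monomial_smul]
  refine monomial_ext φ ρ (fun ξ k => ?_) fun ξ k hk => ?_
  · rw [mul_apply_eq_comp, mul_apply_eq_comp, coord_gauge, coord_monomial_add, coord_gauge,
      act_smul, map_smul, map_smul, smul_apply, smul_smul]
    congr 1
    rw [pow_add, mul_right_comm, ← mul_pow, hzw, one_pow, one_mul]
  · rw [mul_apply_eq_comp, mul_apply_eq_comp, coord_gauge, coord_monomial_lt _ _ _ _ _ _ hk,
      smul_zero]

/-- Multiplying the `k`-th coefficient of a polynomial by `zᵏ`, `|z| ≤ 1`, does not increase the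
norm: on the unit circle this is conjugation by a unitary, inside it the maximum principle. -/
theorem norm_sum_pow_smul_monomial_le (D : ℕ) (a : ℕ → C₀(X, ℂ)) {z : ℂ} (hz : ‖z‖ ≤ 1) :
    ‖∑ k ∈ Finset.range D, z ^ k • monomial φ ρ k (a k)‖ ≤
      ‖∑ k ∈ Finset.range D, monomial φ ρ k (a k)‖ := by
  -- The operator-valued polynomial in `z` is holomorphic, so its norm on the disc is controlled by
  -- the unit circle.
  have hd : Differentiable ℂ fun z : ℂ => ∑ k ∈ Finset.range D, z ^ k • monomial φ ρ k (a k) :=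
    Differentiable.fun_sum fun k _ => (differentiable_pow k).smul_const _
  refine Complex.norm_le_of_forall_mem_frontier_norm_le (Metric.isBounded_ball (x := (0 : ℂ))
    (r := 1)) hd.diffContOnCl (fun w hw => ?_) (z := z)
    (by simpa [closure_ball (0 : ℂ) one_ne_zero] using hz)
  rw [frontier_ball _ one_ne_zero, mem_sphere_zero_iff_norm] at hw
  have hw' : ‖w⁻¹‖ ≤ 1 := by simp [hw]
  have hne : w ≠ 0 := fun h => by simp [h] at hw
  have heq : ∑ k ∈ Finset.range D, w ^ k • monomial φ ρ k (a k) =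
      gauge w hw.le * (∑ k ∈ Finset.range D, monomial φ ρ k (a k)) * gauge w⁻¹ hw' := by
    rw [Finset.mul_sum, Finset.sum_mul]
    exact Finset.sum_congr rfl fun k _ =>
      (gauge_mul_monomial_mul_gauge φ ρ hw.le hw' (mul_inv_cancel₀ hne) k (a k)).symm
  rw [heq]
  refine (norm_mul_le _ _).trans ((mul_le_of_le_one_right (norm_nonneg _)
    (norm_gauge_le _ _)).trans ((norm_mul_le _ _).trans
      (mul_le_of_le_one_left (norm_nonneg _) (norm_gauge_le _ _))))

end Gauge

/-! ### Abel summation of Fourier series. -/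

section Abel

variable {X : Type u} [TopologicalSpace X]
  {H₀ : Type v} [NormedAddCommGroup H₀] [InnerProductSpace ℂ H₀] [CompleteSpace H₀]
  {φ : X ≃ₜ X} {ρ : C₀(X, ℂ) →⋆ₙₐ[ℂ] (H₀ →L[ℂ] H₀)}

theorem norm_pow_smul_monomialIn_fourierCoeff_le (hρ : Function.Injective ρ) (z : ℂ)
    (T : semicrossedProduct φ ρ) (m : ℕ) :
    ‖z ^ m • monomialIn φ ρ m (fourierCoeff φ ρ m T)‖ ≤ ‖z‖ ^ m * ‖T‖ := by
  rw [norm_smul, norm_pow]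
  exact mul_le_mul_of_nonneg_left ((norm_monomialIn_le φ ρ m _).trans
    (norm_fourierCoeff_le φ hρ m T)) (by positivity)

theorem summable_pow_smul_monomialIn (hρ : Function.Injective ρ) {z : ℂ} (hz : ‖z‖ < 1)
    (T : semicrossedProduct φ ρ) :
    Summable fun m => z ^ m • monomialIn φ ρ m (fourierCoeff φ ρ m T) :=
  Summable.of_norm_bounded ((summable_geometric_of_lt_one (norm_nonneg z) hz).mul_right ‖T‖)
    (norm_pow_smul_monomialIn_fourierCoeff_le hρ z T)

/-- The Abel mean `∑ zᵐ Uᵐ Eₘ(T)` of the Fourier series of `T`. -/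
def abelMean (hρ : Function.Injective ρ) (z : ℂ) (hz : ‖z‖ < 1) :
    semicrossedProduct φ ρ →L[ℂ] semicrossedProduct φ ρ :=
  LinearMap.mkContinuous
    { toFun := fun T => ∑' m, z ^ m • monomialIn φ ρ m (fourierCoeff φ ρ m T)
      map_add' := fun S T => by
        rw [← (summable_pow_smul_monomialIn hρ hz S).tsum_add
          (summable_pow_smul_monomialIn hρ hz T)]
        exact tsum_congr fun m => by rw [map_add, map_add, smul_add]
      map_smul' := fun c T => by
        rw [RingHom.id_apply, ← (summable_pow_smul_monomialIn hρ hz T).tsum_const_smul c]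
        exact tsum_congr fun m => by rw [map_smul, map_smul, smul_comm] }
    -- This geometric bound blows up as `|z| → 1` and serves only for continuity; the bound uniform
    -- in `z` is `norm_abelMean_le`.
    (1 - ‖z‖)⁻¹ fun T => tsum_of_norm_bounded
      ((hasSum_geometric_of_lt_one (norm_nonneg z) hz).mul_right ‖T‖)
      (norm_pow_smul_monomialIn_fourierCoeff_le hρ z T)

theorem abelMean_apply (hρ : Function.Injective ρ) (z : ℂ) (hz : ‖z‖ < 1)
    (T : semicrossedProduct φ ρ) :
    abelMean hρ z hz T = ∑' m, z ^ m • monomialIn φ ρ m (fourierCoeff φ ρ m T) := rfl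

theorem abelMean_monomialIn (hρ : Function.Injective ρ) (z : ℂ) (hz : ‖z‖ < 1) (k : ℕ)
    (a : C₀(X, ℂ)) :
    abelMean hρ z hz (monomialIn φ ρ k a) = z ^ k • monomialIn φ ρ k a := by
  rw [abelMean_apply, tsum_eq_single k]
  · rw [fourierCoeff_monomialIn hρ, if_pos rfl]
  · intro m hm
    rw [fourierCoeff_monomialIn hρ, if_neg hm, map_zero, smul_zero]

/-- On a polynomial the mean multiplies the `k`-th term by `zᵏ`, so the gauge estimate applies;
density does the rest. -/
theorem norm_abelMean_le (hρ : Function.Injective ρ) (z : ℂ) (hz : ‖z‖ < 1)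
    (T : semicrossedProduct φ ρ) : ‖abelMean hρ z hz T‖ ≤ ‖T‖ := by
  refine polynomial_induction (p := fun T => ‖abelMean hρ z hz T‖ ≤ ‖T‖)
    (isClosed_le (abelMean hρ z hz).continuous.norm continuous_norm) (fun D a => ?_) T
  rw [map_sum]
  simp only [abelMean_monomialIn]
  have h := norm_sum_pow_smul_monomial_le φ ρ D a hz.le
  have hcoe : ∀ S : semicrossedProduct φ ρ, ‖S‖ = ‖(S : HSpace H₀ →L[ℂ] HSpace H₀)‖ :=
    fun _ => rfl
  rw [hcoe, hcoe]
  simpa using h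

theorem tendsto_abelMean (hρ : Function.Injective ρ) {z : ℕ → ℂ} (hz : ∀ i, ‖z i‖ < 1)
    (hlim : Tendsto z atTop (𝓝 1)) (T : semicrossedProduct φ ρ) :
    Tendsto (fun i => abelMean hρ (z i) (hz i) T) atTop (𝓝 T) := by
  have heq : Equicontinuous fun (i : ℕ) (T : semicrossedProduct φ ρ) =>
      abelMean hρ (z i) (hz i) T := by
    refine fun T => Metric.equicontinuousAt_iff_right.2 fun ε hε => ?_
    filter_upwards [Metric.ball_mem_nhds T hε] with T' hT' i
    rw [dist_eq_norm, ← map_sub]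
    refine (norm_abelMean_le hρ _ _ _).trans_lt ?_
    rwa [← dist_eq_norm, dist_comm]
  refine monomial_induction (p := fun T => Tendsto (fun i => abelMean hρ (z i) (hz i) T) atTop
    (𝓝 T)) (heq.isClosed_setOfPred_tendsto continuous_id) ?_ ?_ T
  · intro S T hS hT
    simpa using hS.add hT
  · intro k a
    simp only [abelMean_monomialIn]
    simpa using (hlim.pow k).smul_const (monomialIn φ ρ k a)

/-- A closed subspace that contains the terms `Uᵐ Eₘ(T)` of the Fourier series of `T`
contains `T`. -/
theorem mem_of_forall_monomialIn_fourierCoeff_mem (hρ : Function.Injective ρ)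
    (T : semicrossedProduct φ ρ) (V : Submodule ℂ (semicrossedProduct φ ρ))
    (hV : IsClosed (V : Set (semicrossedProduct φ ρ)))
    (h : ∀ m, monomialIn φ ρ m (fourierCoeff φ ρ m T) ∈ V) : T ∈ V := by
  -- Any radii below `1` tending to `1` would do; these lie in `[1/2, 1)`.
  have hz : ∀ i : ℕ, ‖(1 - 1 / ((i : ℂ) + 1) / 2 : ℂ)‖ < 1 := by
    intro i
    have hc : (1 - 1 / ((i : ℂ) + 1) / 2 : ℂ) = ((1 - 1 / ((i : ℝ) + 1) / 2 : ℝ) : ℂ) := by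
      push_cast
      rfl
    have hpos : 0 < 1 / ((i : ℝ) + 1) := by positivity
    have hle : 1 / ((i : ℝ) + 1) ≤ 1 := by
      rw [div_le_one (by positivity)]
      linarith [(Nat.cast_nonneg i : (0 : ℝ) ≤ i)]
    rw [hc, Complex.norm_real, Real.norm_of_nonneg (by linarith)]
    linarith
  have hlim : Tendsto (fun i : ℕ => (1 - 1 / ((i : ℂ) + 1) / 2 : ℂ)) atTop (𝓝 1) := by
    simpa using ((tendsto_one_div_add_atTop_nhds_zero_nat (𝕜 := ℂ)).div_const 2).const_sub 1
  refine hV.mem_of_tendsto (tendsto_abelMean hρ hz hlim T) (Eventually.of_forall fun i => ?_)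
  exact hV.mem_of_tendsto (summable_pow_smul_monomialIn hρ (hz i) T).hasSum
    (Eventually.of_forall fun s => Submodule.sum_mem _ fun m _ => Submodule.smul_mem _ _ (h m))

end Abel

/-! ### Soft thresholding and compact weighted composition operators. -/

section Threshold

variable {X : Type u} [TopologicalSpace X]

/-- The soft thresholding of `f`: it vanishes where `|f| ≤ δ` and is `δ`-close to `f`. -/
def softThreshold (δ : ℝ) (hδ : 0 < δ) (f : C₀(X, ℂ)) : C₀(X, ℂ) where
  toFun x := f x * ((1 - δ / max ‖f x‖ δ : ℝ) : ℂ)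
  continuous_toFun := by
    have hne : ∀ x, max ‖f x‖ δ ≠ 0 := fun x => (lt_max_of_lt_right hδ).ne'
    have hf : Continuous f := f.continuous
    exact hf.mul (Complex.continuous_ofReal.comp
      (continuous_const.sub (continuous_const.div (hf.norm.max continuous_const) hne)))
  zero_at_infty' := by
    refine tendsto_const_nhds.congr' ?_
    have h := Metric.tendsto_nhds.1 (zero_at_infty f) δ hδ
    filter_upwards [h] with x hx
    rw [dist_zero_right] at hx
    rw [max_eq_right hx.le, div_self hδ.ne']
    simp

theorem softThreshold_apply (δ : ℝ) (hδ : 0 < δ) (f : C₀(X, ℂ)) (x : X) :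
    softThreshold δ hδ f x = f x * ((1 - δ / max ‖f x‖ δ : ℝ) : ℂ) := rfl

theorem softThreshold_eq_zero {δ : ℝ} (hδ : 0 < δ) {f : C₀(X, ℂ)} {x : X} (h : ‖f x‖ ≤ δ) :
    softThreshold δ hδ f x = 0 := by
  rw [softThreshold_apply, max_eq_right h, div_self hδ.ne']
  simp

theorem norm_softThreshold_sub_le (δ : ℝ) (hδ : 0 < δ) (f : C₀(X, ℂ)) :
    ‖softThreshold δ hδ f - f‖ ≤ δ := by
  refine norm_le_of_forall hδ.le fun x => ?_
  have hpos : 0 < max ‖f x‖ δ := lt_max_of_lt_right hδ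
  have h : (softThreshold δ hδ f - f) x = -(f x * ((δ / max ‖f x‖ δ : ℝ) : ℂ)) := by
    change softThreshold δ hδ f x - f x = _
    rw [softThreshold_apply]
    push_cast
    ring
  rw [h, norm_neg, norm_mul, Complex.norm_real, Real.norm_of_nonneg (by positivity), mul_div_assoc',
    div_le_iff₀ hpos, mul_comm]
  exact mul_le_mul_of_nonneg_left (le_max_left _ _) hδ.le

/-- A closed property of `u f` follows from that property for all thresholds of `f`. -/
theorem of_forall_softThreshold {Y : Type*} [TopologicalSpace Y] {p : Y → Prop}
    (hp : IsClosed {y | p y}) {u : C₀(X, ℂ) → Y} (hu : Continuous u) {f : C₀(X, ℂ)}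
    (h : ∀ δ (hδ : 0 < δ), p (u (softThreshold δ hδ f))) : p (u f) := by
  have hmem : f ∈ closure {k | p (u k)} := by
    refine Metric.mem_closure_iff.2 fun ε hε => ⟨_, h (ε / 2) (half_pos hε), ?_⟩
    rw [dist_comm, dist_eq_norm]
    exact (norm_softThreshold_sub_le _ _ f).trans_lt (half_lt_self hε)
  exact (hp.preimage hu).closure_subset hmem

theorem isCompact_le_norm (f : C₀(X, ℂ)) {δ : ℝ} (hδ : 0 < δ) : IsCompact {x | δ ≤ ‖f x‖} := by
  have h := Metric.tendsto_nhds.1 (zero_at_infty f) δ hδ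
  obtain ⟨t, ht, hsub⟩ := mem_cocompact.1 h
  refine ht.of_isClosed_subset (isClosed_le continuous_const f.continuous.norm) fun x hx => ?_
  by_contra hxt
  have hlt : dist (f x) 0 < δ := hsub hxt
  rw [dist_zero_right] at hlt
  exact absurd hlt (not_lt.2 hx)

/-- A compact set of isolated points is finite. -/
theorem finite_of_isCompact_of_isolated {K : Set X} (hK : IsCompact K)
    (h : ∀ x ∈ K, IsOpen {x}) : K.Finite :=
  hK.induction_on Set.finite_empty (fun _ _ hst ht => ht.subset hst) (fun _ _ => Set.Finite.union)
    fun x hx => ⟨{x}, mem_nhdsWithin_of_mem_nhds ((h x hx).mem_nhds rfl), Set.finite_singleton x⟩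

/-- Evaluation at a point. -/
def evalL (x : X) : C₀(X, ℂ) →L[ℂ] ℂ :=
  LinearMap.mkContinuous
    { toFun := fun f => f x
      map_add' := fun _ _ => rfl
      map_smul' := fun _ _ => rfl } 1 fun f => (norm_apply_le f x).trans_eq (one_mul _).symm

@[simp] theorem evalL_apply (x : X) (f : C₀(X, ℂ)) : evalL x f = f x := rfl

/-- The operator `h ↦ k · (h ∘ φⁿ)` on `C₀(X)`. -/
def weightedComposition (φ : X ≃ₜ X) (n : ℕ) (k : C₀(X, ℂ)) : C₀(X, ℂ) →L[ℂ] C₀(X, ℂ) :=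
  (ContinuousLinearMap.mul ℂ C₀(X, ℂ) k).comp (actL φ n)

@[simp] theorem weightedComposition_apply (φ : X ≃ₜ X) (n : ℕ) (k h : C₀(X, ℂ)) :
    weightedComposition φ n k h = k * act φ n h := rfl

theorem isCompactOperator_finset_sum {ι E F : Type*} [TopologicalSpace E] [AddCommMonoid E]
    [TopologicalSpace F] [AddCommMonoid F] [ContinuousAdd F] (s : Finset ι) {T : ι → E → F}
    (h : ∀ i ∈ s, IsCompactOperator (T i)) : IsCompactOperator fun x => ∑ i ∈ s, T i x := by
  classical
  induction s using Finset.induction_on with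
  | empty =>
    simp only [Finset.sum_empty]
    exact isCompactOperator_zero
  | insert i s hi ih =>
    simp only [Finset.sum_insert hi]
    exact (h i (Finset.mem_insert_self i s)).add
      (ih fun j hj => h j (Finset.mem_insert_of_mem hj))

/-- A threshold of `k` is supported in a compact set of isolated points, hence in a finite set, so
the operator has finite rank; `k` is a norm limit of its thresholds. -/
theorem isCompactOperator_weightedComposition [T2Space X] (φ : X ≃ₜ X) (n : ℕ) (k : C₀(X, ℂ))
    (hk : ∀ x ∈ accumulationPoints X, k x = 0) :
    IsCompactOperator (weightedComposition φ n k) := by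
  classical
  have hcont : Continuous fun k : C₀(X, ℂ) => weightedComposition φ n k :=
    (ContinuousLinearMap.mul ℂ C₀(X, ℂ)).continuous.clm_comp continuous_const
  refine of_forall_softThreshold (p := fun T : C₀(X, ℂ) →L[ℂ] C₀(X, ℂ) => IsCompactOperator T)
    isClosed_setOfPred_isCompactOperator hcont fun δ hδ => ?_
  have hiso : ∀ x ∈ {x | δ ≤ ‖k x‖}, IsOpen {x} := fun x hx =>
    (isolated_or_accumulation x).resolve_right fun hacc => by
      rw [Set.mem_ofPred_eq, hk x hacc, norm_zero] at hx
      exact absurd hδ (not_lt.2 hx)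
  have hfin := finite_of_isCompact_of_isolated (isCompact_le_norm k hδ) hiso
  -- Finite rank made explicit: evaluate `h` at `φⁿ x` and place the weighted value at `x`, for the
  -- finitely many `x` with `|k x| ≥ δ`.
  have hsum : (weightedComposition φ n (softThreshold δ hδ k) : C₀(X, ℂ) → C₀(X, ℂ)) =
      fun h => ∑ x ∈ hfin.toFinset.attach,
        ContinuousLinearMap.toSpanSingleton ℂ (softThreshold δ hδ k x.1 •
          pointMass x.1 (hiso x.1 (hfin.mem_toFinset.1 x.2))) (evalL (φ^[n] x.1) h) := by
    funext h
    ext y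
    have hev : ∀ u : hfin.toFinset → C₀(X, ℂ), (∑ x ∈ hfin.toFinset.attach, u x) y =
        ∑ x ∈ hfin.toFinset.attach, u x y := fun u => map_sum (evalL y) u _
    rw [hev]
    simp only [weightedComposition_apply, ContinuousLinearMap.toSpanSingleton_apply, evalL_apply,
      ZeroAtInftyContinuousMap.mul_apply, ZeroAtInftyContinuousMap.smul_apply, act_apply,
      smul_eq_mul, pointMass_apply]
    by_cases hy : δ ≤ ‖k y‖
    · rw [Finset.sum_eq_single ⟨y, hfin.mem_toFinset.2 hy⟩]
      · simp [mul_comm]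
      · intro x _ hne
        rw [if_neg fun h => hne (Subtype.ext h.symm)]
        simp
      · intro hn
        exact absurd (Finset.mem_attach _ _) hn
    · rw [softThreshold_eq_zero hδ (not_le.1 hy).le, zero_mul]
      refine (Finset.sum_eq_zero fun x _ => ?_).symm
      have hx : δ ≤ ‖k x.1‖ := hfin.mem_toFinset.1 x.2
      rw [if_neg (by rintro rfl; exact hy hx)]
      simp
  rw [hsum]
  exact isCompactOperator_finset_sum _ fun x _ =>
    (isCompactOperator_of_locallyCompactSpace_dom (evalL (φ^[n] x.1))).clm_comp
      (ContinuousLinearMap.toSpanSingleton ℂ _)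

end Threshold

/-! ### The three conditions imply compactness of `M_{A,B}`. -/

section Sufficiency

variable {X : Type u} [TopologicalSpace X]
  {H₀ : Type v} [NormedAddCommGroup H₀] [InnerProductSpace ℂ H₀] [CompleteSpace H₀]
  {φ : X ≃ₜ X} {ρ : C₀(X, ℂ) →⋆ₙₐ[ℂ] (H₀ →L[ℂ] H₀)}

theorem isClosed_isCompactOperator_left (B : semicrossedProduct φ ρ) :
    IsClosed {A | IsCompactOperator (multiplicationOperator φ ρ A B)} :=
  isClosed_setOfPred_isCompactOperator.preimage (continuous_multiplicationOperator_left B)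

theorem isClosed_isCompactOperator_right (A : semicrossedProduct φ ρ) :
    IsClosed {B | IsCompactOperator (multiplicationOperator φ ρ A B)} :=
  isClosed_setOfPred_isCompactOperator.preimage (continuous_multiplicationOperator_right A)

variable (φ ρ) in
/-- The subspace of all `A` for which `M_{A,B}` is compact. -/
def compactLeft (B : semicrossedProduct φ ρ) : Submodule ℂ (semicrossedProduct φ ρ) where
  carrier := {A | IsCompactOperator (multiplicationOperator φ ρ A B)}
  add_mem' {A A'} h h' := by
    rw [Set.mem_ofPred_eq, multiplicationOperator_add_left]
    exact IsCompactOperator.add h h'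
  zero_mem' := by
    have h : (multiplicationOperator φ ρ 0 B : _ → _) = 0 := funext fun T => Subtype.ext (by
      simp [coe_multiplicationOperator_apply])
    rw [Set.mem_ofPred_eq, h]
    exact isCompactOperator_zero
  smul_mem' c A h := by
    rw [Set.mem_ofPred_eq, multiplicationOperator_smul_left]
    exact IsCompactOperator.smul h c

variable (φ ρ) in
/-- The subspace of all `B` for which `M_{A,B}` is compact. -/
def compactRight (A : semicrossedProduct φ ρ) : Submodule ℂ (semicrossedProduct φ ρ) where
  carrier := {B | IsCompactOperator (multiplicationOperator φ ρ A B)}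
  add_mem' {B B'} h h' := by
    rw [Set.mem_ofPred_eq, multiplicationOperator_add_right]
    exact IsCompactOperator.add h h'
  zero_mem' := by
    have h : (multiplicationOperator φ ρ A 0 : _ → _) = 0 := funext fun T => Subtype.ext (by
      simp [coe_multiplicationOperator_apply])
    rw [Set.mem_ofPred_eq, h]
    exact isCompactOperator_zero
  smul_mem' c B h := by
    rw [Set.mem_ofPred_eq, multiplicationOperator_smul_right]
    exact IsCompactOperator.smul h c

/-- Abel summation is applied in one variable at a time, first to `B` with the left factor a
monomial, then to `A`. -/
theorem isCompactOperator_of_forall_monomialIn (hρ : Function.Injective ρ)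
    {A B : semicrossedProduct φ ρ}
    (h : ∀ m n, IsCompactOperator (multiplicationOperator φ ρ
      (monomialIn φ ρ m (fourierCoeff φ ρ m A)) (monomialIn φ ρ n (fourierCoeff φ ρ n B)))) :
    IsCompactOperator (multiplicationOperator φ ρ A B) := by
  have hB : ∀ m, B ∈ compactRight φ ρ (monomialIn φ ρ m (fourierCoeff φ ρ m A)) := fun m =>
    mem_of_forall_monomialIn_fourierCoeff_mem hρ B _ (isClosed_isCompactOperator_right _) (h m)
  have hA : A ∈ compactLeft φ ρ B :=
    mem_of_forall_monomialIn_fourierCoeff_mem hρ A _ (isClosed_isCompactOperator_left B) hB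
  exact hA

/-- If `(f ∘ φⁿ⁺ˡ) g` vanishes for large `l`, then `M_{Uᵐf,Uⁿg}` only depends on finitely many
Fourier coefficients. -/
theorem multiplicationOperator_monomialIn_eq_sum (hρ : Function.Injective ρ) {m n L : ℕ}
    {f g : C₀(X, ℂ)} (hL : ∀ l ≥ L, act φ (n + l) f * g = 0) (T : semicrossedProduct φ ρ) :
    multiplicationOperator φ ρ (monomialIn φ ρ m f) (monomialIn φ ρ n g) T =
      ∑ l ∈ Finset.range L, monomialIn φ ρ (m + l + n)
        (weightedComposition φ n (act φ (n + l) f * g) (fourierCoeff φ ρ l T)) := by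
  refine monomial_induction (p := fun T =>
    multiplicationOperator φ ρ (monomialIn φ ρ m f) (monomialIn φ ρ n g) T =
      ∑ l ∈ Finset.range L, monomialIn φ ρ (m + l + n)
        (weightedComposition φ n (act φ (n + l) f * g) (fourierCoeff φ ρ l T)))
    (isClosed_eq (ContinuousLinearMap.continuous _) (continuous_finsetSum _ fun l _ =>
      (ContinuousLinearMap.continuous _).comp ((ContinuousLinearMap.continuous _).comp
        (ContinuousLinearMap.continuous _)))) ?_ ?_ T
  · intro S T hS hT
    rw [map_add, hS, hT, ← Finset.sum_add_distrib]
    exact Finset.sum_congr rfl fun l _ => by rw [map_add, map_add, map_add]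
  · intro l h
    have hcomm : act φ (l + n) f * act φ n h * g = act φ (n + l) f * g * act φ n h := by
      rw [Nat.add_comm l n, mul_right_comm]
    rw [multiplicationOperator_monomialIn, hcomm]
    by_cases hl : l < L
    · rw [Finset.sum_eq_single l]
      · rw [fourierCoeff_monomialIn hρ, if_pos rfl, weightedComposition_apply]
      · intro j _ hj
        rw [fourierCoeff_monomialIn hρ, if_neg hj, map_zero, map_zero]
      · intro hn
        exact absurd (Finset.mem_range.2 hl) hn
    · rw [hL l (not_lt.1 hl), zero_mul, map_zero]
      refine (Finset.sum_eq_zero fun j hj => ?_).symm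
      rw [Finset.mem_range] at hj
      rw [fourierCoeff_monomialIn hρ, if_neg (by omega), map_zero, map_zero]

theorem isCompactOperator_monomialIn_of_eventually_zero [T2Space X] (hρ : Function.Injective ρ)
    {m n L : ℕ} {f g : C₀(X, ℂ)} (hL : ∀ l ≥ L, act φ (n + l) f * g = 0)
    (hacc : ∀ l, ∀ x ∈ accumulationPoints X, f (φ^[n + l] x) * g x = 0) :
    IsCompactOperator
      (multiplicationOperator φ ρ (monomialIn φ ρ m f) (monomialIn φ ρ n g)) := by
  have h : (multiplicationOperator φ ρ (monomialIn φ ρ m f) (monomialIn φ ρ n g) : _ → _) =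
      fun T => ∑ l ∈ Finset.range L, monomialIn φ ρ (m + l + n)
        (weightedComposition φ n (act φ (n + l) f * g) (fourierCoeff φ ρ l T)) :=
    funext (multiplicationOperator_monomialIn_eq_sum hρ hL)
  rw [h]
  exact isCompactOperator_finset_sum _ fun l _ =>
    ((isCompactOperator_weightedComposition φ n (act φ (n + l) f * g) (hacc l)).comp_clm
      (fourierCoeff φ ρ l)).clm_comp (monomialIn φ ρ (m + l + n))

/-- Under the equicontinuity condition, `(f ∘ φⁿ⁺ˡ) g` tends to zero uniformly on `X`. -/
theorem eventually_norm_mul_lt_of_equicontinuous {n : ℕ} {f g : C₀(X, ℂ)}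
    (hacc : ∀ l, ∀ x ∈ accumulationPoints X, f (φ^[n + l] x) * g x = 0)
    (hiso : ∀ x ∈ isolatedPoints X, Tendsto (fun l : ℕ => f (φ^[n + l] x) * g x) atTop (𝓝 0))
    (heq : Equicontinuous fun (l : ℕ) (x : X) => f (φ^[n + l] x) * g x) {ε : ℝ} (hε : 0 < ε) :
    ∀ᶠ l in atTop, ∀ x, ‖f (φ^[n + l] x) * g x‖ < ε := by
  -- The `+ 1` allows division when `f = 0`. Where `|g| < ε / (‖f‖ + 1)` the product is small for
  -- every `l`; the complement is compact.
  have hpos : 0 < ‖f‖ + 1 := by positivity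
  have h0 : ∀ x, Tendsto (fun l : ℕ => f (φ^[n + l] x) * g x) atTop (𝓝 0) := fun x => by
    rcases isolated_or_accumulation x with hx | hx
    · exact hiso x hx
    · simp only [hacc _ x hx]
      exact tendsto_const_nhds
  filter_upwards [eventually_forall_norm_lt_of_equicontinuous heq h0
    (isCompact_le_norm g (div_pos hε hpos)) hε] with l hl x
  by_cases hx : ε / (‖f‖ + 1) ≤ ‖g x‖
  · exact hl x hx
  · rw [not_le, lt_div_iff₀ hpos] at hx
    rw [norm_mul]
    calc ‖f (φ^[n + l] x)‖ * ‖g x‖ ≤ (‖f‖ + 1) * ‖g x‖ :=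
          mul_le_mul_of_nonneg_right ((norm_apply_le f _).trans (by linarith)) (norm_nonneg _)
      _ < ε := by rwa [mul_comm]

theorem isCompactOperator_monomialIn_softThreshold [T2Space X] (hρ : Function.Injective ρ)
    (m : ℕ) {n : ℕ} {f g : C₀(X, ℂ)}
    (hacc : ∀ l, ∀ x ∈ accumulationPoints X, f (φ^[n + l] x) * g x = 0)
    (hiso : ∀ x ∈ isolatedPoints X, Tendsto (fun l : ℕ => f (φ^[n + l] x) * g x) atTop (𝓝 0))
    (heq : Equicontinuous fun (l : ℕ) (x : X) => f (φ^[n + l] x) * g x)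
    {δ δ' : ℝ} (hδ : 0 < δ) (hδ' : 0 < δ') :
    IsCompactOperator (multiplicationOperator φ ρ (monomialIn φ ρ m (softThreshold δ hδ f))
      (monomialIn φ ρ n (softThreshold δ' hδ' g))) := by
  -- The bound `δ δ'` is chosen so that for `l ≥ L` no point has both `|f ∘ φ^{n+l}| > δ` and `|g| >
  -- δ'`; one of the two thresholded factors is therefore zero.
  obtain ⟨L, hL⟩ := eventually_atTop.1
    (eventually_norm_mul_lt_of_equicontinuous hacc hiso heq (mul_pos hδ hδ'))
  have hzero : ∀ l ≥ L, act φ (n + l) (softThreshold δ hδ f) * softThreshold δ' hδ' g = 0 := by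
    intro l hl
    ext x
    change softThreshold δ hδ f (φ^[n + l] x) * softThreshold δ' hδ' g x = 0
    by_cases h1 : ‖f (φ^[n + l] x)‖ ≤ δ
    · rw [softThreshold_eq_zero hδ h1, zero_mul]
    by_cases h2 : ‖g x‖ ≤ δ'
    · rw [softThreshold_eq_zero hδ' h2, mul_zero]
    have h := hL l hl x
    rw [norm_mul] at h
    exact absurd h (not_lt.2 (mul_le_mul (not_le.1 h1).le (not_le.1 h2).le hδ'.le (norm_nonneg _)))
  refine isCompactOperator_monomialIn_of_eventually_zero hρ hzero fun l x hx => ?_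
  -- Thresholding multiplies pointwise by a scalar, so zeros of the product persist.
  rw [softThreshold_apply, softThreshold_apply, mul_mul_mul_comm, hacc l x hx, zero_mul]

theorem isCompactOperator_of_forall_softThreshold {m n : ℕ} {f g : C₀(X, ℂ)}
    (h : ∀ δ δ' (hδ : 0 < δ) (hδ' : 0 < δ'), IsCompactOperator (multiplicationOperator φ ρ
      (monomialIn φ ρ m (softThreshold δ hδ f)) (monomialIn φ ρ n (softThreshold δ' hδ' g)))) :
    IsCompactOperator
      (multiplicationOperator φ ρ (monomialIn φ ρ m f) (monomialIn φ ρ n g)) := by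
  refine of_forall_softThreshold
    (p := fun A => IsCompactOperator (multiplicationOperator φ ρ A (monomialIn φ ρ n g)))
    (isClosed_isCompactOperator_left _) (monomialIn φ ρ m).continuous fun δ hδ => ?_
  exact of_forall_softThreshold
    (p := fun B => IsCompactOperator (multiplicationOperator φ ρ _ B))
    (isClosed_isCompactOperator_right _) (monomialIn φ ρ n).continuous fun δ' hδ' => h δ δ' hδ hδ'

theorem isCompactOperator_monomialIn [T2Space X] (hρ : Function.Injective ρ) (m : ℕ) {n : ℕ}
    {f g : C₀(X, ℂ)} (hacc : ∀ l, ∀ x ∈ accumulationPoints X, f (φ^[n + l] x) * g x = 0)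
    (hiso : ∀ x ∈ isolatedPoints X, Tendsto (fun l : ℕ => f (φ^[n + l] x) * g x) atTop (𝓝 0))
    (heq : Equicontinuous fun (l : ℕ) (x : X) => f (φ^[n + l] x) * g x) :
    IsCompactOperator
      (multiplicationOperator φ ρ (monomialIn φ ρ m f) (monomialIn φ ρ n g)) :=
  isCompactOperator_of_forall_softThreshold fun _ _ hδ hδ' =>
    isCompactOperator_monomialIn_softThreshold hρ m hacc hiso heq hδ hδ'

end Sufficiency

end Semicrossed

end

theorem theorem2p6 {X : Type*} [TopologicalSpace X] [LocallyCompactSpace X]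
    [TopologicalSpace.MetrizableSpace X] (φ : X ≃ₜ X)
    {H₀ : Type*} [NormedAddCommGroup H₀] [InnerProductSpace ℂ H₀] [CompleteSpace H₀]
    (ρ : C₀(X, ℂ) →⋆ₙₐ[ℂ] (H₀ →L[ℂ] H₀)) (hρ : Function.Injective ρ)
    (A B : Semicrossed.semicrossedProduct φ ρ) (f g : ℕ → C₀(X, ℂ))
    (hf : ∀ m, Semicrossed.fourierCoeff φ ρ m A = f m) (hg : ∀ n, Semicrossed.fourierCoeff φ ρ n B = g n) :
    IsCompactOperator (Semicrossed.multiplicationOperator φ ρ A B) ↔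
      ∀ m n : ℕ,
        (∀ l : ℕ, ∀ x ∈ Semicrossed.accumulationPoints X, f m (φ^[n + l] x) * g n x = 0) ∧
        (∀ x ∈ Semicrossed.isolatedPoints X,
          Filter.Tendsto (fun l : ℕ => f m (φ^[n + l] x) * g n x) Filter.atTop (nhds 0)) ∧
        Equicontinuous (fun (l : ℕ) (x : X) => f m (φ^[n + l] x) * g n x) := by
  obtain rfl : (fun m => Semicrossed.fourierCoeff φ ρ m A) = f := funext hf
  obtain rfl : (fun n => Semicrossed.fourierCoeff φ ρ n B) = g := funext hg
  constructor
  · intro hM m n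
    refine ⟨fun l x hx =>
      Semicrossed.fourierCoeff_mul_eq_zero_of_mem_accumulationPoints hρ hM m n l hx,
      fun x hx => Semicrossed.tendsto_fourierCoeff_mul_of_isolated hρ hM m n hx,
      Semicrossed.equicontinuous_of_eventually_norm_lt (fun l => ?_) fun ε hε =>
        Semicrossed.eventually_norm_fourierCoeff_mul_lt hρ hM m n hε⟩
    exact ((Semicrossed.fourierCoeff φ ρ m A).continuous.comp (φ.continuous.iterate _)).mul
      (Semicrossed.fourierCoeff φ ρ n B).continuous
  · intro h
    exact Semicrossed.isCompactOperator_of_forall_monomialIn hρ fun m n =>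
      Semicrossed.isCompactOperator_monomialIn hρ m (h m n).1 (h m n).2.1 (h m n).2.2
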